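/- **Terms.** Fix parameters $p_1,\dots,p_k$ ($k\ge 0$). Arithmetic terms are built from background variables and number constants (integers and finite decimals) with $\sin,\cos,+,\times,\wedge,/$. Terms are built from foreground variables, numbers, parameters and quoted terms $\langle a\rangle=\mathrm{kwote}(a)$, $a$ an arithmetic term, with the unary symbols $\sin,\cos,\mathrm s$ and the binary symbols $+,\times,\wedge,/,\mathrm{sin\_n},\mathrm{cos\_n},\mathrm{pwr\_n}$. Quoted terms are opaque for rewriting; substitutions map foreground variables to terms and background variables to arithmetic terms. Ground means without variables of either sort. **Rewriting.** Let $\mathrm{simp}$ be a function from arithmetic terms to arithmetic terms that fixes numbers and sends ground terms to numbers; $t{\downarrow}$ replaces each $\langle a\rangle$ in $t$ by $\langle\mathrm{simp}(a)\rangle$. A rule $l\to r\mid C$ has a finite set $C$ of formulas, and all its variables occur in $l$. Fix a satisfaction relation $I$ on constraints with $I\models\emptyset$ that is stable under substitution. If $I\models C\delta$, then $l\delta\Rightarrow r\delta$ is an ordinary instance of the rule. The rule rewrites $t[l\delta]$ to $t[(r\delta){\downarrow}]$ when $l\delta\Rightarrow r\delta$ is an ordinary instance, $l\delta$ is not a variable,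 and in $l$ and in $l\delta$ only numbers and variables are quoted. A set $R$ of rules is terminating if there is no infinite sequence of rewrite steps with rules of $R$ from any term. **Orderings.** Let $X=(x_1>\dots>x_n)$ be a list of distinct foreground variables. Let $\succ$ (an AWPO) be the weighted path ordering defined as follows. Each arithmetic term is treated as a constant symbol below all function symbols and parameters, and $\langle a\rangle$ is the unary symbol $\mathrm{kwote}$ applied to the constant $a$. The precedence is total on function symbols and parameters, extends $\sin>\cos>\wedge>\times>+>p_1>\dots>p_k>\mathrm{kwote}$, has $\mathrm{kwote}$ as its least function symbol or parameter, contains $x_1>\dots>x_n$, and leaves the constants pairwise unrelated and variables unrelated to all other symbols. Each binary symbol has a left-to-right or right-to-left status. Weights are positive integers: variables are assigned arbitrary positive integers with $x_1\ge\dots\ge x_n$ on $X$, and weights are compared for all these assignments; numbers, parameters and quoted terms have weight $1$; and $w(\mathrm s(n))=w(n)+1$, $w(x+y)=1+w(x)+w(y)$, $w(x\times y)=2w(x)w(y)$, $w(x\wedge y)=2w(x)^2w(y)$, $w(\sin x)=w(\cos x)=2^{3w(x)}$, $w(\mathrm{sin\_n}(n,x))=w(\mathrm{cos\_n}(n,x))=(2\cdot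 2^{3w(x)}+1)^{2w(n)}$, $w(\mathrm{pwr\_n}(x,n))=(2^{w(n)}+1)^{w(x)}$, while $w(x/y)=g(w(x),w(y))$ for a fixed weakly monotone $g$ on the positive integers with $g(a,b)\ge a,b$. The ground-total extension $\succ^t$ is the same ordering with any fixed strict total precedence between the numbers added. A rule $l\to r\mid C$ is **well-behaved** (for $I$) if (a) $s\succ t$ for each ordinary instance $s\Rightarrow t$ of it, or (b) $s\succ^t t$ for each ordinary instance $s\Rightarrow t$ of it, and for every ground ordinary instance $l\gamma\Rightarrow r\gamma$: (b1) every quoted term in $r\gamma$ also occurs in $l\gamma$; (b2) for every ground term $s$ and every ground $t[l\gamma]$, if $s\succ t[l\gamma]$ then $s\succ t[r\gamma]$. **Theorem.** Every set $R$ of well-behaved rules is terminating. Moreover, let the constraint $x\succ y$ be evaluated by $\succ^t$. Then the following systems are terminating ($a,b$ are background and $x,y,z,v,n$ foreground variables). Canon, provided that all binary symbols have left-to-right status: - $(x+y)+z\to x+(y+z)$; $\ x+y\to y+x\mid x\succ y$; $\ x+(y+z)\to y+(x+z)\mid x\succ y$; $\ \langle0\rangle+x\to x$; $\ \langle a\rangle+\langle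 b\rangle\to\langle a+b\rangle$; $\ \langle a\rangle+(\langle b\rangle+z)\to\langle a+b\rangle+z$; $\ (\langle a\rangle\times x)+(\langle b\rangle\times x)\to\langle a+b\rangle\times x$; $\ (\langle a\rangle\times x)+((\langle b\rangle\times x)+z)\to(\langle a+b\rangle\times x)+z$; - $(x\times y)\times z\to x\times(y\times z)$; $\ x\times y\to y\times x\mid x\succ y$; $\ x\times(y\times z)\to y\times(x\times z)\mid x\succ y$; $\ \langle0\rangle\times x\to\langle0\rangle$; $\ \langle a\rangle\times\langle b\rangle\to\langle a\times b\rangle$; $\ \langle a\rangle\times(\langle b\rangle\times z)\to\langle a\times b\rangle\times z$; $\ x\times(y+z)\to(x\times y)+(x\times z)$; $\ (y+z)\times x\to(y\times x)+(z\times x)$; - $(x\wedge y)\wedge z\to x\wedge(y\times z)$; $\ (x\wedge y)\times(x\wedge z)\to x\wedge(y+z)$; $\ (x\wedge y)\times((x\wedge z)\times v)\to(x\wedge(y+z))\times v$; $\ \langle a\rangle\wedge\langle b\rangle\to\langle a\wedge b\rangle$; $\ \mathrm{pwr\_n}(x,\langle0\rangle)\to\langle1\rangle$; $\ \mathrm{pwr\_n}(x,\mathrm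 s(n))\to x\times\mathrm{pwr\_n}(x,n)$; $\ (x+y)\wedge\langle1\rangle\to x+y$; $\ (x\times y)\wedge\langle a\rangle\to(x\wedge\langle a\rangle)\times(y\wedge\langle a\rangle)$; $\ x\wedge\langle0\rangle\to\langle1\rangle$; - $\sin(\langle-1\rangle\times x)\to\langle-1\rangle\times\sin x$; $\ \cos(\langle-1\rangle\times x)\to\cos x$; $\ \sin(x+y)\to(\sin x\times\cos y)+(\cos x\times\sin y)$; $\ \cos(x+y)\to(\cos x\times\cos y)+((\langle-1\rangle\times\sin x)\times\sin y)$; $\ \mathrm{cos\_n}(\mathrm s(\mathrm s(n)),x)\to(\langle2\rangle\times(\cos x\times\mathrm{cos\_n}(\mathrm s(n),x)))+(\langle-1\rangle\times\mathrm{cos\_n}(n,x))$; $\ \mathrm{sin\_n}(\mathrm s(\mathrm s(n)),x)\to((\langle2\rangle\times\cos x)\times\mathrm{sin\_n}(\mathrm s(n),x))+(\langle-1\rangle\times\mathrm{sin\_n}(n,x))$; $\ \sin x\wedge\langle2\rangle\to\langle1\rangle+(\langle-1\rangle\times(\cos x\wedge\langle2\rangle))$; $\ \mathrm{cos\_n}(\mathrm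 s(\langle0\rangle),x)\to\cos(\langle1\rangle\times x)$; $\ \mathrm{cos\_n}(\langle0\rangle,x)\to\cos\langle0\rangle$; $\ \mathrm{sin\_n}(\mathrm s(\langle0\rangle),x)\to\sin(\langle1\rangle\times x)$; $\ \mathrm{sin\_n}(\langle0\rangle,x)\to\sin\langle0\rangle$; $\ \sin\langle a\rangle\to\langle\sin a\rangle$; $\ \cos\langle a\rangle\to\langle\cos a\rangle$. Simp, provided that $\times$ has right-to-left and every other binary symbol left-to-right status: - $(\langle a\rangle\times x)+(\langle b\rangle\times y)\to(\langle b\rangle\times y)+(\langle a\rangle\times x)\mid x\succ y$; $\ (\langle a\rangle\times x)+((\langle b\rangle\times y)+z)\to(\langle b\rangle\times y)+((\langle a\rangle\times x)+z)\mid x\succ y$; $\ (\langle a\rangle\times x)+(\langle b\rangle\times x)\to\langle a+b\rangle\times x$; $\ (\langle a\rangle\times x)+((\langle b\rangle\times x)+z)\to(\langle a+b\rangle\times x)+z$. -/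

import Mathlib

namespace Ari

/-! ## Terms -/

/-- Number constants: the integers and the finite decimals. -/
def Number : Type := {q : ℚ // ∃ (m : ℤ) (e : ℕ), q = (m : ℚ) / 10 ^ e}

/-- An integer as a number constant. -/
def Number.ofInt (n : ℤ) : Number := ⟨(n : ℚ), n, 0, by simp⟩

/-- Arithmetic terms: parameter-free and quote-free terms over `+`, `×`, `^`, `/`, `sin`, `cos`,
numbers and (background) variables. These are the terms that can be quoted. -/
inductive ATerm : Type
  | var (x : ℕ)
  | num (q : Number)
  | sin (t : ATerm)
  | cos (t : ATerm)
  | add (s t : ATerm)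
  | mul (s t : ATerm)
  | pow (s t : ATerm)
  | div (s t : ATerm)

/-- The unary function symbols other than the quotation symbol. -/
inductive Fn1 : Type
  | sin | cos | succ

/-- The binary function symbols. -/
inductive Fn2 : Type
  | add | mul | pow | div | sinN | cosN | pwrN

/-- Terms with parameters `p₁, …, p_k`. A quoted term is a black box, hence `quote` takes an
arithmetic term. Variables are of two sorts: the variables of `Term` are foreground variables, those
of `ATerm` are background variables; so no variable is both, quoted terms contain no parameters, and
quotations are not nested. -/
inductive Term (k : ℕ) : Type
  | var (x : ℕ)
  | num (q : Number)
  | param (i : Fin k)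
  | quote (a : ATerm)
  | app1 (f : Fn1) (t : Term k)
  | app2 (f : Fn2) (s t : Term k)

/-- The variables of an arithmetic term. -/
def ATerm.vars : ATerm → Finset ℕ
  | .var x => {x}
  | .num _ => ∅
  | .sin t => t.vars
  | .cos t => t.vars
  | .add s t => s.vars ∪ t.vars
  | .mul s t => s.vars ∪ t.vars
  | .pow s t => s.vars ∪ t.vars
  | .div s t => s.vars ∪ t.vars

/-- Foreground variables of a term. -/
def Term.fgVars {k : ℕ} : Term k → Finset ℕ
  | .var x => {x}
  | .num _ => ∅
  | .param _ => ∅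
  | .quote _ => ∅
  | .app1 _ t => t.fgVars
  | .app2 _ s t => s.fgVars ∪ t.fgVars

/-- Background variables of a term. -/
def Term.bgVars {k : ℕ} : Term k → Finset ℕ
  | .var _ => ∅
  | .num _ => ∅
  | .param _ => ∅
  | .quote a => a.vars
  | .app1 _ t => t.bgVars
  | .app2 _ s t => s.bgVars ∪ t.bgVars

/-- A term without variables of either sort. -/
def Term.Ground {k : ℕ} (t : Term k) : Prop := t.fgVars = ∅ ∧ t.bgVars = ∅

/-- The set of those `a` for which the quotation of `a` occurs in the term. -/
def Term.quotes {k : ℕ} : Term k → Set ATerm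
  | .var _ => ∅
  | .num _ => ∅
  | .param _ => ∅
  | .quote a => {a}
  | .app1 _ t => t.quotes
  | .app2 _ s t => s.quotes ∪ t.quotes

/-- The term is not a (foreground) variable. -/
def Term.NonVar {k : ℕ} (t : Term k) : Prop := ∀ x, t ≠ .var x

/-! ## Substitutions and contexts -/

/-- A substitution respecting the two sorts of variables. -/
structure Subst (k : ℕ) where
  fg : ℕ → Term k
  bg : ℕ → ATerm

/-- Application of a substitution to an arithmetic term. -/
def ATerm.subst (σ : ℕ → ATerm) : ATerm → ATerm
  | .var x => σ x
  | .num q => .num q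
  | .sin t => .sin (t.subst σ)
  | .cos t => .cos (t.subst σ)
  | .add s t => .add (s.subst σ) (t.subst σ)
  | .mul s t => .mul (s.subst σ) (t.subst σ)
  | .pow s t => .pow (s.subst σ) (t.subst σ)
  | .div s t => .div (s.subst σ) (t.subst σ)

/-- Application of a substitution to a term. -/
def Term.subst {k : ℕ} (δ : Subst k) : Term k → Term k
  | .var x => δ.fg x
  | .num q => .num q
  | .param i => .param i
  | .quote a => .quote (a.subst δ.bg)
  | .app1 f t => .app1 f (t.subst δ)
  | .app2 f s t => .app2 f (s.subst δ) (t.subst δ)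

/-- Terms with one hole; the hole is never inside a quotation. -/
inductive Ctx (k : ℕ) : Type
  | hole
  | app1 (f : Fn1) (c : Ctx k)
  | app2l (f : Fn2) (c : Ctx k) (t : Term k)
  | app2r (f : Fn2) (t : Term k) (c : Ctx k)

/-- Plugging a term into the hole of a context. -/
def Ctx.fill {k : ℕ} : Ctx k → Term k → Term k
  | .hole, u => u
  | .app1 f c, u => .app1 f (c.fill u)
  | .app2l f c t, u => .app2 f (c.fill u) t
  | .app2r f t c, u => .app2 f t (c.fill u)

/-! ## Simplification -/

/-- The requirements on the simplification function of quoted terms that concern syntax: numbers are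
left alone, and ground terms simplify to numbers. No soundness is required. -/
structure IsCanonizer (simp : ATerm → ATerm) : Prop where
  num : ∀ q, simp (.num q) = .num q
  ground : ∀ a : ATerm, a.vars = ∅ → ∃ q, simp a = .num q

/-- Homomorphic extension of `simp`: every quoted term is simplified. -/
def Term.simplify {k : ℕ} (simp : ATerm → ATerm) : Term k → Term k
  | .var x => .var x
  | .num q => .num q
  | .param i => .param i
  | .quote a => .quote (simp a)
  | .app1 f t => .app1 f (t.simplify simp)
  | .app2 f s t => .app2 f (s.simplify simp) (t.simplify simp)

/-! ## Constrained rules -/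

/-- Constraint formulas: ordering atoms, other atoms, and Boolean combinations. -/
inductive Formula (k : ℕ) : Type
  | gt (s t : Term k)
  | pred (p : ℕ) (args : List (Term k))
  | neg (φ : Formula k)
  | conj (φ ψ : Formula k)
  | disj (φ ψ : Formula k)

/-- Application of a substitution to a formula. -/
def Formula.subst {k : ℕ} (δ : Subst k) : Formula k → Formula k
  | .gt s t => .gt (s.subst δ) (t.subst δ)
  | .pred p args => .pred p (args.map (Term.subst δ))
  | .neg φ => .neg (φ.subst δ)
  | .conj φ ψ => .conj (φ.subst δ) (ψ.subst δ)
  | .disj φ ψ => .disj (φ.subst δ) (ψ.subst δ)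

/-- All terms that occur as arguments in a formula. -/
def Formula.terms {k : ℕ} : Formula k → Set (Term k)
  | .gt s t => {s, t}
  | .pred _ args => {t | t ∈ args}
  | .neg φ => φ.terms
  | .conj φ ψ => φ.terms ∪ ψ.terms
  | .disj φ ψ => φ.terms ∪ ψ.terms

/-- A constrained rewrite rule `lhs → rhs | C`; the constraint is a finite set of formulas. -/
structure Rule (k : ℕ) where
  lhs : Term k
  rhs : Term k
  C : Set (Formula k)
  finite_C : C.Finite
  rhs_fg : rhs.fgVars ⊆ lhs.fgVars
  rhs_bg : rhs.bgVars ⊆ lhs.bgVars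
  C_fg : ∀ φ ∈ C, ∀ t ∈ φ.terms, t.fgVars ⊆ lhs.fgVars
  C_bg : ∀ φ ∈ C, ∀ t ∈ φ.terms, t.bgVars ⊆ lhs.bgVars

/-- A satisfaction relation, given as the set of the satisfied constraints: the empty constraint is
satisfied, and satisfaction is stable under substitution. -/
structure IsSatisfaction {k : ℕ} (I : Set (Set (Formula k))) : Prop where
  empty : ∅ ∈ I
  stable : ∀ C ∈ I, ∀ δ : Subst k, Formula.subst δ '' C ∈ I

/-- `lδ ⇒ rδ` is an ordinary instance of the rule via `δ`, i.e. `Cδ` is satisfied. -/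
def Rule.OrdinaryVia {k : ℕ} (I : Set (Set (Formula k))) (ρ : Rule k) (δ : Subst k) : Prop :=
  Formula.subst δ '' ρ.C ∈ I

/-- Admissibility of a rule with left-hand side `l`: every quoted term in `l` is a number or a
variable. The two other requirements (no variable is both background and foreground; quoted terms
are free of parameters and quotations) hold by the typing of terms. -/
def AdmissibleLhs {k : ℕ} (l : Term k) : Prop :=
  ∀ a ∈ l.quotes, (∃ q, a = .num q) ∨ ∃ x, a = .var x

/-! ## Rewriting -/

/-- One-step rewriting with simplification by a rule. -/
def Rule.Step {k : ℕ} (simp : ATerm → ATerm) (I : Set (Set (Formula k))) (ρ : Rule k)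
    (t s : Term k) : Prop :=
  AdmissibleLhs ρ.lhs ∧
  ∃ (c : Ctx k) (δ : Subst k),
    AdmissibleLhs (ρ.lhs.subst δ) ∧ (ρ.lhs.subst δ).NonVar ∧ ρ.OrdinaryVia I δ ∧
    t = c.fill (ρ.lhs.subst δ) ∧ s = c.fill ((ρ.rhs.subst δ).simplify simp)

/-- There is no infinite sequence of one-step rewrites with rules from `R`, from any term. -/
def Terminating {k : ℕ} (simp : ATerm → ATerm) (I : Set (Set (Formula k))) (R : Set (Rule k)) :
    Prop :=
  ¬ ∃ t : ℕ → Term k, ∀ n, ∃ ρ ∈ R, ρ.Step simp I (t n) (t (n + 1))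

/-! ## The weighted path ordering -/

/-- The terms compared by the path ordering: every arithmetic term `a` is a constant symbol `cst a`,
and the quotation of `a` is the unary symbol `kwote` applied to `cst a`. -/
inductive FTerm (k : ℕ) : Type
  | var (x : ℕ)
  | cst (a : ATerm)
  | param (i : Fin k)
  | kwote (a : ATerm)
  | app1 (f : Fn1) (t : FTerm k)
  | app2 (f : Fn2) (s t : FTerm k)

/-- A term as a term over the signature of the path ordering. -/
def Term.toF {k : ℕ} : Term k → FTerm k
  | .var x => .var x
  | .num q => .cst (.num q)
  | .param i => .param i
  | .quote a => .kwote a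
  | .app1 f t => .app1 f t.toF
  | .app2 f s t => .app2 f s.toF t.toF

/-- Function symbols and parameters. -/
inductive Sym (k : ℕ) : Type
  | fn1 (f : Fn1)
  | fn2 (f : Fn2)
  | param (i : Fin k)
  | kwote

/-- Head symbols. -/
inductive Head (k : ℕ) : Type
  | var (x : ℕ)
  | cst (a : ATerm)
  | sym (f : Sym k)

/-- Head symbol of a term. -/
def FTerm.head {k : ℕ} : FTerm k → Head k
  | .var x => .var x
  | .cst a => .cst a
  | .param i => .sym (.param i)
  | .kwote _ => .sym .kwote
  | .app1 f _ => .sym (.fn1 f)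
  | .app2 f _ _ => .sym (.fn2 f)

/-- Immediate subterms. -/
def FTerm.args {k : ℕ} : FTerm k → List (FTerm k)
  | .var _ => []
  | .cst _ => []
  | .param _ => []
  | .kwote a => [.cst a]
  | .app1 _ t => [t]
  | .app2 _ s t => [s, t]

/-- What is left open in the definition of the ordering: a total precedence on the function symbols
and parameters, which extends
`sin > cos > ^ > × > + > p₁ > ⋯ > p_k > kwote` and has `kwote` as its least element (given by ranks);
the status (`true` for left-to-right) of the binary symbols; a weakly monotone and weakly simple
weight for `/` on the positive integers; and the variable precedence `X = (x₁ > x₂ > ⋯ > x_n)`. -/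
structure AWPO (k : ℕ) where
  rank : Sym k → ℕ
  rank_injective : Function.Injective rank
  sin_cos : rank (.fn1 .cos) < rank (.fn1 .sin)
  cos_pow : rank (.fn2 .pow) < rank (.fn1 .cos)
  pow_mul : rank (.fn2 .mul) < rank (.fn2 .pow)
  mul_add : rank (.fn2 .add) < rank (.fn2 .mul)
  add_param : ∀ i, rank (.param i) < rank (.fn2 .add)
  param_param : ∀ i j : Fin k, i < j → rank (.param j) < rank (.param i)
  kwote_least : ∀ f, f ≠ .kwote → rank .kwote < rank f
  ltr : Fn2 → Bool
  wdiv : ℕ → ℕ → ℕ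
  wdiv_mono : ∀ a a' b b', 1 ≤ a → 1 ≤ b → a ≤ a' → b ≤ b' → wdiv a b ≤ wdiv a' b'
  wdiv_left : ∀ a b, 1 ≤ a → 1 ≤ b → a ≤ wdiv a b
  wdiv_right : ∀ a b, 1 ≤ a → 1 ≤ b → b ≤ wdiv a b
  X : List ℕ
  X_nodup : X.Nodup

/-- Weight of a term under an assignment of weights to the variables. -/
def FTerm.weight {k : ℕ} (wdiv : ℕ → ℕ → ℕ) (α : ℕ → ℕ) : FTerm k → ℕ
  | .var x => α x
  | .cst _ => 1
  | .param _ => 1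
  | .kwote _ => 1
  | .app1 .sin t => 2 ^ (t.weight wdiv α * 3)
  | .app1 .cos t => 2 ^ (t.weight wdiv α * 3)
  | .app1 .succ t => t.weight wdiv α + 1
  | .app2 .add s t => 1 + (s.weight wdiv α + t.weight wdiv α)
  | .app2 .mul s t => 2 * s.weight wdiv α * t.weight wdiv α
  | .app2 .pow s t => (s.weight wdiv α * s.weight wdiv α) * (2 * t.weight wdiv α)
  | .app2 .div s t => wdiv (s.weight wdiv α) (t.weight wdiv α)
  | .app2 .sinN n t => (2 * 2 ^ (t.weight wdiv α * 3) + 1) ^ (2 * n.weight wdiv α)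
  | .app2 .cosN n t => (2 * 2 ^ (t.weight wdiv α * 3) + 1) ^ (2 * n.weight wdiv α)
  | .app2 .pwrN t n => (2 ^ (n.weight wdiv α) + 1) ^ (t.weight wdiv α)

namespace AWPO

variable {k : ℕ}

/-- Assignments of positive integers to the variables that respect `X`. -/
def Assignment (D : AWPO k) (α : ℕ → ℕ) : Prop :=
  (∀ x, 1 ≤ α x) ∧ D.X.Pairwise (fun x y => α y ≤ α x)

/-- Strict comparison of weights. -/
def WGt (D : AWPO k) (s t : FTerm k) : Prop :=
  ∀ α, D.Assignment α → t.weight D.wdiv α < s.weight D.wdiv α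

/-- Non-strict comparison of weights. -/
def WGe (D : AWPO k) (s t : FTerm k) : Prop :=
  ∀ α, D.Assignment α → t.weight D.wdiv α ≤ s.weight D.wdiv α

/-- The strict precedence, where `N` is the precedence between numbers. -/
def Prec (D : AWPO k) (N : Number → Number → Prop) : Head k → Head k → Prop
  | .sym f, .sym g => D.rank g < D.rank f
  | .sym _, .cst _ => True
  | .cst (.num m), .cst (.num n) => N m n
  | .var x, .var y => ∃ l₁ l₂ l₃, D.X = l₁ ++ x :: (l₂ ++ y :: l₃)
  | _, _ => False

/-- Immediate subterms in the order given by the status. -/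
def statusArgs (D : AWPO k) : FTerm k → List (FTerm k)
  | .app2 f s t => if D.ltr f then [s, t] else [t, s]
  | t => t.args

/-- The weighted path ordering. -/
inductive FGt (D : AWPO k) (N : Number → Number → Prop) : FTerm k → FTerm k → Prop
  | weight {s t} : D.WGt s t → FGt D N s t
  | subEq {s t} : D.WGe s t → t ∈ s.args → FGt D N s t
  | sub {s t u} : D.WGe s t → u ∈ s.args → FGt D N u t → FGt D N s t
  | prec {s t} : D.WGe s t → D.Prec N s.head t.head → (∀ u ∈ t.args, FGt D N s u) → FGt D N s t
  | lex {s t} (pre : List (FTerm k)) (u v : FTerm k) (us vs : List (FTerm k)) :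
      D.WGe s t → s.head = t.head → (∀ w ∈ t.args, FGt D N s w) →
      D.statusArgs s = pre ++ u :: us → D.statusArgs t = pre ++ v :: vs → FGt D N u v →
      FGt D N s t

/-- The ordering `≻`: numbers are pairwise unrelated in the precedence. -/
def Gt (D : AWPO k) (s t : Term k) : Prop := D.FGt (fun _ _ => False) s.toF t.toF

/-- The ground-total extension `≻ᵗ` of `≻` by the precedence `N` between numbers. -/
def GtT (D : AWPO k) (N : Number → Number → Prop) (s t : Term k) : Prop := D.FGt N s.toF t.toF

end AWPO

/-! ## Well-behaved rules -/

/-- The rule is oriented with respect to ordinary instances. -/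
def Rule.Oriented {k : ℕ} (I : Set (Set (Formula k))) (gt : Term k → Term k → Prop)
    (ρ : Rule k) : Prop :=
  ∀ δ : Subst k, ρ.OrdinaryVia I δ → gt (ρ.lhs.subst δ) (ρ.rhs.subst δ)

/-- The two alternatives in the definition of a well-behaved rule. -/
def Rule.WellBehaved {k : ℕ} (D : AWPO k) (N : Number → Number → Prop) (I : Set (Set (Formula k)))
    (ρ : Rule k) : Prop :=
  ρ.Oriented I D.Gt ∨
  (ρ.Oriented I (D.GtT N) ∧
    ∀ γ : Subst k, ρ.OrdinaryVia I γ → (ρ.lhs.subst γ).Ground →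
      (ρ.rhs.subst γ).quotes ⊆ (ρ.lhs.subst γ).quotes ∧
      ∀ (s : Term k) (c : Ctx k), s.Ground → (c.fill (ρ.lhs.subst γ)).Ground →
        D.Gt s (c.fill (ρ.lhs.subst γ)) → D.Gt s (c.fill (ρ.rhs.subst γ)))

/-- Satisfaction of conjunctions of ordering atoms, where ordering atoms are evaluated by `gt`. -/
def orderSat {k : ℕ} (gt : Term k → Term k → Prop) : Set (Set (Formula k)) :=
  {C | ∀ φ ∈ C, ∃ s t, φ = .gt s t ∧ gt s t}

/-! ## The rewrite systems Canon and Simp -/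

section Systems

variable {k : ℕ}

/-- Sum. -/
def Term.add (s t : Term k) : Term k := .app2 .add s t
/-- Product. -/
def Term.mul (s t : Term k) : Term k := .app2 .mul s t
/-- Power. -/
def Term.pow (s t : Term k) : Term k := .app2 .pow s t

local infixl:65 " +ₜ " => Term.add
local infixl:70 " *ₜ " => Term.mul
local infixr:75 " ^ₜ " => Term.pow

/-- The sine of a term. -/
def Term.sin (t : Term k) : Term k := .app1 .sin t
/-- The cosine of a term. -/
def Term.cos (t : Term k) : Term k := .app1 .cos t
/-- Successor. -/
def Term.succ (t : Term k) : Term k := .app1 .succ t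
/-- The term `sin_n(n, t)`. -/
def Term.sinN (n t : Term k) : Term k := .app2 .sinN n t
/-- The term `cos_n(n, t)`. -/
def Term.cosN (n t : Term k) : Term k := .app2 .cosN n t
/-- The term `pwr_n(t, n)`. -/
def Term.pwrN (t n : Term k) : Term k := .app2 .pwrN t n
/-- A quoted integer. -/
def Term.qint (n : ℤ) : Term k := .quote (.num (Number.ofInt n))

/-- Foreground variables. -/
def vx : Term k := .var 0
def vy : Term k := .var 1
def vz : Term k := .var 2
def vv : Term k := .var 3
def vn : Term k := .var 4

/-- Background variables. -/
def ba : ATerm := .var 0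
def bb : ATerm := .var 1
/-- Quoted background variables. -/
def qa : Term k := .quote ba
def qb : Term k := .quote bb

/-- The rule without constraint from `l` to `r`. -/
def Rule.plain (l r : Term k)
    (h₁ : decide (r.fgVars ⊆ l.fgVars) = true := by rfl)
    (h₂ : decide (r.bgVars ⊆ l.bgVars) = true := by rfl) : Rule k where
  lhs := l
  rhs := r
  C := ∅
  finite_C := Set.finite_empty
  rhs_fg := of_decide_eq_true h₁
  rhs_bg := of_decide_eq_true h₂
  C_fg := by simp
  C_bg := by simp

/-- The rule from `l` to `r` with the constraint `x ≻ y`. -/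
def Rule.ordered (l r : Term k)
    (h₁ : decide (r.fgVars ⊆ l.fgVars) = true := by rfl)
    (h₂ : decide (r.bgVars ⊆ l.bgVars) = true := by rfl)
    (h₃ : decide ({0, 1} ⊆ l.fgVars) = true := by rfl) : Rule k where
  lhs := l
  rhs := r
  C := {.gt vx vy}
  finite_C := Set.finite_singleton _
  rhs_fg := of_decide_eq_true h₁
  rhs_bg := of_decide_eq_true h₂
  C_fg := by
    have h0 : (0 : ℕ) ∈ l.fgVars := of_decide_eq_true h₃ (by simp)
    have h1 : (1 : ℕ) ∈ l.fgVars := of_decide_eq_true h₃ (by simp)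
    simp [Formula.terms, vx, vy, Term.fgVars, h0, h1]
  C_bg := by simp [Formula.terms, vx, vy, Term.bgVars]

/-- The rewrite system Canon. -/
def canon (k : ℕ) : Set (Rule k) := {
  -- addition
  .plain ((vx +ₜ vy) +ₜ vz) (vx +ₜ (vy +ₜ vz)),
  .ordered (vx +ₜ vy) (vy +ₜ vx),
  .ordered (vx +ₜ (vy +ₜ vz)) (vy +ₜ (vx +ₜ vz)),
  .plain (.qint 0 +ₜ vx) vx,
  .plain (qa +ₜ qb) (.quote (.add ba bb)),
  .plain (qa +ₜ (qb +ₜ vz)) (.quote (.add ba bb) +ₜ vz),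
  .plain ((qa *ₜ vx) +ₜ (qb *ₜ vx)) (.quote (.add ba bb) *ₜ vx),
  .plain ((qa *ₜ vx) +ₜ ((qb *ₜ vx) +ₜ vz)) ((.quote (.add ba bb) *ₜ vx) +ₜ vz),
  -- multiplication
  .plain ((vx *ₜ vy) *ₜ vz) (vx *ₜ (vy *ₜ vz)),
  .ordered (vx *ₜ vy) (vy *ₜ vx),
  .ordered (vx *ₜ (vy *ₜ vz)) (vy *ₜ (vx *ₜ vz)),
  .plain (.qint 0 *ₜ vx) (.qint 0),
  .plain (qa *ₜ qb) (.quote (.mul ba bb)),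
  .plain (qa *ₜ (qb *ₜ vz)) (.quote (.mul ba bb) *ₜ vz),
  .plain (vx *ₜ (vy +ₜ vz)) ((vx *ₜ vy) +ₜ (vx *ₜ vz)),
  .plain ((vy +ₜ vz) *ₜ vx) ((vy *ₜ vx) +ₜ (vz *ₜ vx)),
  -- exponentiation
  .plain ((vx ^ₜ vy) ^ₜ vz) (vx ^ₜ (vy *ₜ vz)),
  .plain ((vx ^ₜ vy) *ₜ (vx ^ₜ vz)) (vx ^ₜ (vy +ₜ vz)),
  .plain ((vx ^ₜ vy) *ₜ ((vx ^ₜ vz) *ₜ vv)) ((vx ^ₜ (vy +ₜ vz)) *ₜ vv),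
  .plain (qa ^ₜ qb) (.quote (.pow ba bb)),
  .plain (.pwrN vx (.qint 0)) (.qint 1),
  .plain (.pwrN vx (.succ vn)) (vx *ₜ .pwrN vx vn),
  .plain ((vx +ₜ vy) ^ₜ .qint 1) (vx +ₜ vy),
  .plain ((vx *ₜ vy) ^ₜ qa) ((vx ^ₜ qa) *ₜ (vy ^ₜ qa)),
  .plain (vx ^ₜ .qint 0) (.qint 1),
  -- trigonometry
  .plain (.sin (.qint (-1) *ₜ vx)) (.qint (-1) *ₜ .sin vx),
  .plain (.cos (.qint (-1) *ₜ vx)) (.cos vx),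
  .plain (.sin (vx +ₜ vy)) ((.sin vx *ₜ .cos vy) +ₜ (.cos vx *ₜ .sin vy)),
  .plain (.cos (vx +ₜ vy)) ((.cos vx *ₜ .cos vy) +ₜ ((.qint (-1) *ₜ .sin vx) *ₜ .sin vy)),
  .plain (.cosN (.succ (.succ vn)) vx)
    ((.qint 2 *ₜ (.cos vx *ₜ .cosN (.succ vn) vx)) +ₜ (.qint (-1) *ₜ .cosN vn vx)),
  .plain (.sinN (.succ (.succ vn)) vx)
    (((.qint 2 *ₜ .cos vx) *ₜ .sinN (.succ vn) vx) +ₜ (.qint (-1) *ₜ .sinN vn vx)),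
  .plain (.sin vx ^ₜ .qint 2) (.qint 1 +ₜ (.qint (-1) *ₜ (.cos vx ^ₜ .qint 2))),
  .plain (.cosN (.succ (.qint 0)) vx) (.cos (.qint 1 *ₜ vx)),
  .plain (.cosN (.qint 0) vx) (.cos (.qint 0)),
  .plain (.sinN (.succ (.qint 0)) vx) (.sin (.qint 1 *ₜ vx)),
  .plain (.sinN (.qint 0) vx) (.sin (.qint 0)),
  .plain (.sin qa) (.quote (.sin ba)),
  .plain (.cos qa) (.quote (.cos ba)) }

/-- The rewrite system Simp. -/
def simpSystem (k : ℕ) : Set (Rule k) := {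
  .ordered ((qa *ₜ vx) +ₜ (qb *ₜ vy)) ((qb *ₜ vy) +ₜ (qa *ₜ vx)),
  .ordered ((qa *ₜ vx) +ₜ ((qb *ₜ vy) +ₜ vz)) ((qb *ₜ vy) +ₜ ((qa *ₜ vx) +ₜ vz)),
  .plain ((qa *ₜ vx) +ₜ (qb *ₜ vx)) (.quote (.add ba bb) *ₜ vx),
  .plain ((qa *ₜ vx) +ₜ ((qb *ₜ vx) +ₜ vz)) ((.quote (.add ba bb) *ₜ vx) +ₜ vz) }

end Systems

end Ari

/-! The path ordering is closed under contexts and well-founded on the terms whose numbers lie in a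
set `A`, provided that the converse of the precedence of numbers is well-founded on `A`
(`acc_below`). For `≻`, where numbers are unrelated, every `A` qualifies; for `≻ᵗ`, every finite `A`
does.

For well-behaved rules the difficulty is that a reduct is simplified after the step. Each term is
therefore replaced by its grounding: foreground variables become `0`, and each quoted term becomes
its limit under iteration of `simp`. Since `limit simp ∘ simp = limit simp`, groundings do not see
simplification, and every rewrite step becomes a strict descent in `≻`
(`Rule.WellBehaved.gt_grounding`). In case (a) this holds because `I` is stable and because `≻`
survives any change of constants that fixes numbers. In case (b) the grounding is a ground ordinary
instance, and (b2), tested on sums, upgrades `≻ᵗ` to `≻` (`AWPO.Gt.of_sum_replacement`).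

Canon and Simp are treated directly, by a strictly monotone size that ignores constants. Each rule
either decreases the size or only permutes subterms. In an infinite derivation the size is
eventually constant, so only permuting steps remain. These introduce no new numbers and descend in
`≻ᵗ` once quoted terms are replaced by limits. Only finitely many numbers are then involved, which
contradicts well-foundedness. -/

namespace Ari

open FTerm AWPO

variable {k : ℕ}

/-! ## Well-foundedness of lexicographic comparison -/

/-- Induction on lists of accessible elements of a fixed length, where lists are compared
lexicographically. -/
theorem list_lex_induction {β : Type*} {r : β → β → Prop} (n : ℕ) :
    ∀ {P : List β → Prop},
      (∀ L : List β, L.length = n → (∀ a ∈ L, Acc r a) →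
        (∀ (pre : List β) (u v : β) (us vs : List β), L = pre ++ u :: us →
          (pre ++ v :: vs).length = n → (∀ a ∈ pre ++ v :: vs, Acc r a) → r v u →
          P (pre ++ v :: vs)) → P L) →
      ∀ L : List β, L.length = n → (∀ a ∈ L, Acc r a) → P L := by
  induction n with
  | zero =>
    intro P step L hL hacc
    refine step L hL hacc ?_
    rintro pre u v us vs rfl
    simp at hL
  | succ n ih =>
    intro P step L hL hacc
    obtain ⟨a, l, rfl⟩ : ∃ a l, L = a :: l := by
      cases L with
      | nil => simp at hL
      | cons a l => exact ⟨a, l, rfl⟩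
    -- Accessibility of the head is the outer induction, the claim for shorter lists the inner one:
    -- a decrease at the head leaves the new tail free, as long as it is accessible.
    have key : ∀ a, Acc r a → ∀ l : List β, l.length = n → (∀ b ∈ l, Acc r b) → P (a :: l) := by
      intro a ha
      induction ha with
      | intro a ha' iha =>
        refine ih (P := fun l => P (a :: l)) ?_
        intro l hl hlacc IH
        refine step (a :: l) (by simp [hl]) ?_ ?_
        · intro b hb
          rcases List.mem_cons.1 hb with rfl | hb
          · exact ⟨_, ha'⟩
          · exact hlacc b hb
        · intro pre u v us vs hpre hlen hacc' hvu
          cases pre with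
          | nil =>
            simp only [List.nil_append, List.cons.injEq] at hpre
            obtain ⟨rfl, rfl⟩ := hpre
            exact iha v hvu vs (by simpa using hlen)
              (fun b hb => hacc' b (by simp [hb]))
          | cons p pre =>
            simp only [List.cons_append, List.cons.injEq] at hpre
            obtain ⟨rfl, rfl⟩ := hpre
            exact IH pre u v us vs rfl (by simpa using hlen)
              (fun b hb => hacc' b (List.mem_cons_of_mem _ hb)) hvu
    exact key a (hacc a (by simp)) l (by simpa using hL) (fun b hb => hacc b (by simp [hb]))

/-! ## Weights -/

theorem FTerm.weight_pos (D : AWPO k) {α : ℕ → ℕ} (hα : ∀ x, 1 ≤ α x) (t : FTerm k) :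
    1 ≤ t.weight D.wdiv α := by
  induction t with
  | var x => exact hα x
  | cst a => simp [weight]
  | param i => simp [weight]
  | kwote a => simp [weight]
  | app1 f t ih => cases f <;> simp [weight, Nat.one_le_two_pow]
  | app2 f s t ihs iht =>
    cases f <;> simp only [weight]
    · omega
    · exact Nat.mul_pos (Nat.mul_pos two_pos ihs) iht
    · exact Nat.mul_pos (Nat.mul_pos ihs ihs) (Nat.mul_pos two_pos iht)
    · exact ihs.trans (D.wdiv_left _ _ ihs iht)
    · exact Nat.pow_pos (by omega)
    · exact Nat.pow_pos (by omega)
    · exact Nat.pow_pos (Nat.succ_pos _)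

theorem FTerm.weight_app1_mono (D : AWPO k) (α : ℕ → ℕ) (f : Fn1) {s t : FTerm k}
    (h : t.weight D.wdiv α ≤ s.weight D.wdiv α) :
    (app1 f t).weight D.wdiv α ≤ (app1 f s).weight D.wdiv α := by
  cases f <;> simp only [weight]
  · exact Nat.pow_le_pow_right two_pos (by omega)
  · exact Nat.pow_le_pow_right two_pos (by omega)
  · omega

theorem FTerm.weight_app2_mono (D : AWPO k) {α : ℕ → ℕ} (hα : ∀ x, 1 ≤ α x) (f : Fn2)
    {s s' t t' : FTerm k}
    (hs : s'.weight D.wdiv α ≤ s.weight D.wdiv α) (ht : t'.weight D.wdiv α ≤ t.weight D.wdiv α) :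
    (app2 f s' t').weight D.wdiv α ≤ (app2 f s t).weight D.wdiv α := by
  have h1 := weight_pos D hα s'
  have h2 := weight_pos D hα t'
  have e : ∀ {a b : ℕ}, a ≤ b → 2 * 2 ^ (a * 3) + 1 ≤ 2 * 2 ^ (b * 3) + 1 := fun {a b} h => by
    have := Nat.pow_le_pow_right two_pos (Nat.mul_le_mul_right 3 h)
    omega
  cases f <;> simp only [weight]
  · omega
  · gcongr
  · gcongr
  · exact D.wdiv_mono _ _ _ _ h1 h2 hs ht
  · exact (Nat.pow_le_pow_left (e ht) _).trans (Nat.pow_le_pow_right (by omega) (by omega))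
  · exact (Nat.pow_le_pow_left (e ht) _).trans (Nat.pow_le_pow_right (by omega) (by omega))
  · have := Nat.pow_le_pow_right two_pos ht
    exact (Nat.pow_le_pow_left (Nat.succ_le_succ this) _).trans
      (Nat.pow_le_pow_right (Nat.succ_pos _) hs)

theorem le_base_pow {b n : ℕ} (hb : 2 ≤ b) : n ≤ b ^ n :=
  (Nat.lt_pow_self (by omega)).le

theorem FTerm.weight_arg_le (D : AWPO k) {α : ℕ → ℕ} (hα : ∀ x, 1 ≤ α x) {t u : FTerm k}
    (hu : u ∈ t.args) : u.weight D.wdiv α ≤ t.weight D.wdiv α := by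
  have e : ∀ a, a ≤ 2 ^ (a * 3) := fun a =>
    le_trans (by omega) (le_base_pow (b := 2) (n := a * 3) le_rfl)
  cases t with
  | var x => simp [args] at hu
  | cst a => simp [args] at hu
  | param i => simp [args] at hu
  | kwote a =>
    simp only [args, List.mem_singleton] at hu
    simp [hu, weight]
  | app1 f t =>
    simp only [args, List.mem_singleton] at hu
    subst hu
    cases f <;> simp only [weight]
    · exact e _
    · exact e _
    · omega
  | app2 f s t =>
    have h1 := weight_pos D hα s
    have h2 := weight_pos D hα t
    have hpow : ∀ {b n : ℕ}, 1 ≤ n → b ≤ b ^ n := fun {b n} hn => by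
      exact Nat.le_self_pow (by omega) b
    suffices h : s.weight D.wdiv α ≤ (app2 f s t).weight D.wdiv α ∧
        t.weight D.wdiv α ≤ (app2 f s t).weight D.wdiv α by
      simp only [args, List.mem_cons, List.not_mem_nil, or_false] at hu
      rcases hu with rfl | rfl
      exacts [h.1, h.2]
    cases f <;> simp only [weight]
    · omega
    · constructor <;> nlinarith
    · constructor
      · nlinarith [Nat.mul_le_mul h1 h2, Nat.mul_le_mul_left (s.weight D.wdiv α) h1,
          Nat.mul_le_mul_left (s.weight D.wdiv α * s.weight D.wdiv α) h2]
      · nlinarith [Nat.mul_le_mul_right (t.weight D.wdiv α) (Nat.mul_le_mul h1 h1)]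
    · exact ⟨D.wdiv_left _ _ h1 h2, D.wdiv_right _ _ h1 h2⟩
    · have := e (t.weight D.wdiv α)
      exact ⟨le_trans (by omega) (le_base_pow (n := 2 * s.weight D.wdiv α) (by omega)),
        le_trans (by omega) (hpow (by omega))⟩
    · have := e (t.weight D.wdiv α)
      exact ⟨le_trans (by omega) (le_base_pow (n := 2 * s.weight D.wdiv α) (by omega)),
        le_trans (by omega) (hpow (by omega))⟩
    · have := le_base_pow (n := t.weight D.wdiv α) (le_refl 2)
      exact ⟨le_base_pow (by omega), le_trans (by omega) (hpow h1)⟩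

namespace AWPO

variable (D : AWPO k) {N : Number → Number → Prop}

theorem assignment_one : D.Assignment (fun _ => 1) :=
  ⟨fun _ => le_rfl, List.pairwise_of_forall (fun _ _ => le_rfl)⟩

variable {D}

theorem WGt.wge {s t : FTerm k} (h : D.WGt s t) : D.WGe s t := fun α hα => (h α hα).le

theorem WGe.trans {s t u : FTerm k} (h : D.WGe s t) (h' : D.WGe t u) : D.WGe s u :=
  fun α hα => (h' α hα).trans (h α hα)

theorem wge_of_mem_args {s u : FTerm k} (hu : u ∈ s.args) : D.WGe s u :=
  fun _ hα => FTerm.weight_arg_le D hα.1 hu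

theorem FGt.wge {s t : FTerm k} (h : D.FGt N s t) : D.WGe s t := by
  cases h with
  | weight h => exact h.wge
  | subEq h => exact h
  | sub h => exact h
  | prec h => exact h
  | lex _ _ _ _ _ h => exact h

theorem fGt_of_mem_args {s u : FTerm k} (hu : u ∈ s.args) : D.FGt N s u :=
  .subEq (wge_of_mem_args hu) hu

theorem FGt.of_arg {s t u : FTerm k} (hu : u ∈ s.args) (h : D.FGt N u t) : D.FGt N s t :=
  .sub ((wge_of_mem_args hu).trans h.wge) hu h

/-! ## Closure under contexts -/

theorem FGt.app1 (f : Fn1) {s t : FTerm k} (h : D.FGt N s t) :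
    D.FGt N (.app1 f s) (.app1 f t) := by
  refine .lex [] s t [] [] (fun α hα => FTerm.weight_app1_mono D α f (h.wge α hα)) rfl ?_ rfl rfl h
  intro w hw
  simp only [args, List.mem_singleton] at hw
  subst hw
  exact h.of_arg (by simp [args])

/-- The weight of `/` is only weakly monotone, so a strict decrease of weight may be lost under the
symbol. The lexicographic clause needs only `WGe` and works for either status. -/
theorem FGt.app2_left (f : Fn2) (x : FTerm k) {s t : FTerm k} (h : D.FGt N s t) :
    D.FGt N (.app2 f s x) (.app2 f t x) := by
  have hw : D.WGe (.app2 f s x) (.app2 f t x) := fun α hα =>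
    FTerm.weight_app2_mono D hα.1 f (h.wge α hα) le_rfl
  have ha : ∀ w ∈ (FTerm.app2 f t x).args, D.FGt N (.app2 f s x) w := by
    intro w hw
    simp only [args, List.mem_cons, List.not_mem_nil, or_false] at hw
    rcases hw with rfl | rfl
    · exact h.of_arg (by simp [args])
    · exact fGt_of_mem_args (by simp [args])
  by_cases hf : D.ltr f
  · exact .lex [] s t [x] [x] hw rfl ha (by simp [statusArgs, hf]) (by simp [statusArgs, hf]) h
  · exact .lex [x] s t [] [] hw rfl ha (by simp [statusArgs, hf]) (by simp [statusArgs, hf]) h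

theorem FGt.app2_right (f : Fn2) (x : FTerm k) {s t : FTerm k} (h : D.FGt N s t) :
    D.FGt N (.app2 f x s) (.app2 f x t) := by
  have hw : D.WGe (.app2 f x s) (.app2 f x t) := fun α hα =>
    FTerm.weight_app2_mono D hα.1 f le_rfl (h.wge α hα)
  have ha : ∀ w ∈ (FTerm.app2 f x t).args, D.FGt N (.app2 f x s) w := by
    intro w hw
    simp only [args, List.mem_cons, List.not_mem_nil, or_false] at hw
    rcases hw with rfl | rfl
    · exact fGt_of_mem_args (by simp [args])
    · exact h.of_arg (by simp [args])
  by_cases hf : D.ltr f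
  · exact .lex [x] s t [] [] hw rfl ha (by simp [statusArgs, hf]) (by simp [statusArgs, hf]) h
  · exact .lex [] s t [x] [x] hw rfl ha (by simp [statusArgs, hf]) (by simp [statusArgs, hf]) h

theorem FGt.fill (c : Ctx k) {s t : Term k} (h : D.FGt N s.toF t.toF) :
    D.FGt N (c.fill s).toF (c.fill t).toF := by
  induction c with
  | hole => exact h
  | app1 f c ih => exact ih.app1 f
  | app2l f c u ih => exact ih.app2_left f u.toF
  | app2r f u c ih => exact ih.app2_right f u.toF

end AWPO

/-! ## Relabelling of constants -/

/-- Replacement of the constants of a term. -/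
def FTerm.relabel (φ : ATerm → ATerm) : FTerm k → FTerm k
  | .var x => .var x
  | .cst a => .cst (φ a)
  | .param i => .param i
  | .kwote a => .kwote (φ a)
  | .app1 f t => .app1 f (t.relabel φ)
  | .app2 f s t => .app2 f (s.relabel φ) (t.relabel φ)

@[simp] theorem FTerm.weight_relabel (φ : ATerm → ATerm) (g : ℕ → ℕ → ℕ) (α : ℕ → ℕ)
    (t : FTerm k) : (t.relabel φ).weight g α = t.weight g α := by
  induction t with
  | var x => rfl
  | cst a => rfl
  | param i => rfl
  | kwote a => rfl
  | app1 f t ih => cases f <;> simp [relabel, weight, ih]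
  | app2 f s t ihs iht => cases f <;> simp [relabel, weight, ihs, iht]

theorem FTerm.args_relabel (φ : ATerm → ATerm) (t : FTerm k) :
    (t.relabel φ).args = t.args.map (relabel φ) := by
  cases t <;> simp [relabel, args]

theorem AWPO.statusArgs_relabel (D : AWPO k) (φ : ATerm → ATerm) (t : FTerm k) :
    D.statusArgs (t.relabel φ) = (D.statusArgs t).map (relabel φ) := by
  cases t with
  | app2 f s t => by_cases hf : D.ltr f <;> simp [relabel, statusArgs, hf]
  | _ => simp [relabel, statusArgs, args]

/-- Head of a relabelled term. -/
def Head.relabel (φ : ATerm → ATerm) : Head k → Head k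
  | .cst a => .cst (φ a)
  | h => h

theorem FTerm.head_relabel (φ : ATerm → ATerm) (t : FTerm k) :
    (t.relabel φ).head = t.head.relabel φ := by
  cases t <;> rfl

theorem AWPO.Prec.relabel {D : AWPO k} {N : Number → Number → Prop} {φ : ATerm → ATerm}
    (hφ : ∀ q, φ (.num q) = .num q) : ∀ {g h : Head k}, D.Prec N g h →
      D.Prec N (g.relabel φ) (h.relabel φ)
  | .sym _, .sym _, h => h
  | .sym _, .cst _, _ => trivial
  | .cst (.num m), .cst (.num n), h => by
    simp only [Head.relabel, hφ]
    exact h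
  | .var _, .var _, h => h

/-- Weights do not see constants, and the precedence relates two constants only if both are numbers,
which `φ` fixes. Hence comparisons survive even if `φ` identifies constants. -/
theorem AWPO.FGt.relabel {D : AWPO k} {N : Number → Number → Prop} {φ : ATerm → ATerm}
    (hφ : ∀ q, φ (.num q) = .num q) {s t : FTerm k} (h : D.FGt N s t) :
    D.FGt N (s.relabel φ) (t.relabel φ) := by
  have hw : ∀ {s t : FTerm k}, D.WGe s t → D.WGe (s.relabel φ) (t.relabel φ) :=
    fun h α hα => by simpa using h α hα
  induction h with
  | weight h => exact .weight fun α hα => by simpa using h α hα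
  | subEq h hm => exact .subEq (hw h) (by rw [args_relabel]; exact List.mem_map_of_mem hm)
  | sub h hm _ ih =>
    exact .sub (hw h) (by rw [args_relabel]; exact List.mem_map_of_mem hm) ih
  | prec h hp _ ih =>
    refine .prec (hw h) (by simpa only [head_relabel] using hp.relabel hφ) ?_
    intro u hu
    rw [args_relabel] at hu
    obtain ⟨u', hu', rfl⟩ := List.mem_map.1 hu
    exact ih u' hu'
  | lex pre u v us vs h hh _ hs ht _ ih ihuv =>
    refine .lex (pre.map (FTerm.relabel φ)) _ _ (us.map (FTerm.relabel φ))
      (vs.map (FTerm.relabel φ)) (hw h)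
      (by simp only [head_relabel, hh]) ?_ (by simp [statusArgs_relabel, hs])
      (by simp [statusArgs_relabel, ht]) ihuv
    intro u hu
    rw [args_relabel] at hu
    obtain ⟨u', hu', rfl⟩ := List.mem_map.1 hu
    exact ih u' hu'

/-! ## Well-foundedness -/

/-- The numbers that occur as constants. -/
def FTerm.numbers : FTerm k → Set Number
  | .var _ => ∅
  | .cst a => {q | a = .num q}
  | .param _ => ∅
  | .kwote a => {q | a = .num q}
  | .app1 _ t => t.numbers
  | .app2 _ s t => s.numbers ∪ t.numbers

theorem FTerm.finite_numbers (t : FTerm k) : t.numbers.Finite := by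
  have h : ∀ a : ATerm, {q | a = .num q}.Finite := fun a =>
    Set.Subsingleton.finite fun q hq r hr => by
      simp only [Set.mem_ofPred_eq] at hq hr
      rw [hq] at hr
      exact ATerm.num.inj hr
  induction t with
  | var x => exact Set.finite_empty
  | cst a => exact h a
  | param i => exact Set.finite_empty
  | kwote a => exact h a
  | app1 f t ih => exact ih
  | app2 f s t ihs iht => exact ihs.union iht

theorem FTerm.numbers_subset_of_mem_args {t u : FTerm k} (hu : u ∈ t.args) :
    u.numbers ⊆ t.numbers := by
  cases t with
  | app2 f s t =>
    simp only [args, List.mem_cons, List.not_mem_nil, or_false] at hu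
    rcases hu with rfl | rfl <;> simp [numbers]
  | _ => simp_all [args, numbers]

theorem FTerm.args_induction {P : FTerm k → Prop} (h : ∀ t, (∀ u ∈ t.args, P u) → P t)
    (t : FTerm k) : P t := by
  induction t with
  | kwote a => exact h _ (by simpa [args] using h (.cst a) (by simp [args]))
  | app1 f t ih => exact h _ (by simpa [args] using ih)
  | app2 f s t ihs iht => exact h _ (by simpa [args] using ⟨ihs, iht⟩)
  | _ => exact h _ (by simp [args])

theorem not_acc_of_descending {β : Type*} {r : β → β → Prop} {f : ℕ → β}
    (h : ∀ n, r (f (n + 1)) (f n)) : ¬ Acc r (f 0) := by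
  intro hacc
  obtain ⟨b, hb⟩ : ∃ b, b = f 0 := ⟨_, rfl⟩
  rw [← hb] at hacc
  have : ∀ b, Acc r b → ∀ n, b ≠ f n := by
    intro b hb
    induction hb with
    | intro b _ ih =>
      rintro n rfl
      exact ih _ (h n) (n + 1) rfl
  exact this b hacc 0 hb

namespace AWPO

/-- The converse of the path ordering on the terms with numbers in `A`. -/
def Below (D : AWPO k) (N : Number → Number → Prop) (A : Set Number) (s t : FTerm k) : Prop :=
  s.numbers ⊆ A ∧ D.FGt N t s

variable {D : AWPO k} {N : Number → Number → Prop} {A : Set Number}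

theorem mem_args_of_mem_statusArgs {t u : FTerm k} (hu : u ∈ D.statusArgs t) : u ∈ t.args := by
  cases t with
  | app2 f s t =>
    by_cases hf : D.ltr f <;> simp [statusArgs, hf] at hu <;> simp [args]
    · exact hu
    · exact hu.symm
  | _ => exact hu

theorem length_statusArgs {s t : FTerm k} (h : s.head = t.head) :
    (D.statusArgs s).length = (D.statusArgs t).length := by
  have aux : ∀ f (s t : FTerm k), (D.statusArgs (.app2 f s t)).length = 2 := fun f s t => by
    by_cases hf : D.ltr f <;> simp [statusArgs, hf]
  cases s <;> cases t <;> simp_all [head] <;> simp [statusArgs, args]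

/-- No term weighs less than `1`, and without arguments the subterm and lexicographic clauses are
void; only the precedence is left. -/
theorem FGt.prec_of_leaf {s t : FTerm k} (hs : s.args = [])
    (h1 : s.weight D.wdiv (fun _ => 1) = 1) (h : D.FGt N s t) : D.Prec N s.head t.head := by
  cases h with
  | weight h =>
    have := h _ D.assignment_one
    have := FTerm.weight_pos D (α := fun _ => 1) (fun _ => le_rfl) t
    omega
  | subEq h hm => simp [hs] at hm
  | sub h hm => simp [hs] at hm
  | prec h hp => exact hp
  | lex pre u v us vs h hh ha hs' =>
    have : u ∈ s.args := mem_args_of_mem_statusArgs (D := D) (by simp [hs'])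
    simp [hs] at this

theorem acc_cst (hA : A.WellFoundedOn fun m n => N n m) (a : ATerm)
    (ha : (FTerm.cst a : FTerm k).numbers ⊆ A) : Acc (D.Below N A) (.cst a) := by
  have hnum : ∀ q ∈ A, Acc (D.Below N A) (.cst (.num q)) := by
    intro q hq
    refine hA.induction (P := fun q => Acc (D.Below N A) (.cst (.num q))) hq ?_
    intro m hm ih
    refine ⟨_, fun s hs => ?_⟩
    have hp := hs.2.prec_of_leaf rfl rfl
    cases s with
    | cst b =>
      cases b with
      | num n => exact ih n (hs.1 (by simp [numbers])) hp
      | _ => exact absurd hp (by simp [head, Prec])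
    | _ => exact absurd hp (by simp [head, Prec])
  by_cases h : ∃ q, a = .num q
  · obtain ⟨q, rfl⟩ := h
    exact hnum q (ha (by simp [numbers]))
  · refine ⟨_, fun s hs => ?_⟩
    have hp := hs.2.prec_of_leaf rfl rfl
    cases a with
    | num q => exact absurd ⟨q, rfl⟩ h
    | _ => cases s <;> exact absurd hp (by simp [head, Prec])

theorem acc_var (x : ℕ) : Acc (D.Below N A) (.var x) := by
  -- Below a variable there are only variables further right in `X`. For a variable outside `X`,
  -- `idxOf` is the length and the measure is `0`.
  induction h : D.X.length - D.X.idxOf x using Nat.strong_induction_on generalizing x with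
  | _ n ih =>
    refine ⟨_, fun s hs => ?_⟩
    have hp := hs.2.prec_of_leaf rfl rfl
    cases s with
    | var y =>
      obtain ⟨l₁, l₂, l₃, hX⟩ := hp
      refine ih _ ?_ y rfl
      have hnd := D.X_nodup
      rw [hX] at hnd h ⊢
      have hx : x ∉ l₁ := fun hx => by
        have := (List.nodup_append.1 hnd).2.2 x hx x (by simp)
        exact this rfl
      have hy1 : y ∉ l₁ := fun hy => by
        have := (List.nodup_append.1 hnd).2.2 y hy y (by simp)
        exact this rfl
      have hxy : x ≠ y := by
        rintro rfl
        have := (List.nodup_append.1 hnd).2.1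
        simp at this
      rw [List.idxOf_append_of_notMem hx, List.idxOf_cons_self] at h
      rw [List.idxOf_append_of_notMem hy1, List.idxOf_cons_ne _ hxy]
      simp only [List.length_append, List.length_cons] at h ⊢
      omega
    | _ => exact absurd hp (by simp [head, Prec])

/-- Nested induction on the weight under the assignment `1`, the rank of the head, and the list of
arguments in status order. A term `s` below `t` is treated by induction on subterms: the precedence
and lexicographic clauses put `t` above every argument of `s`, so these arguments are already
accessible. -/
theorem acc_below (hA : A.WellFoundedOn fun m n => N n m) (t : FTerm k) (ht : t.numbers ⊆ A) :
    Acc (D.Below N A) t := by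
  let W : FTerm k → ℕ := fun t => t.weight D.wdiv fun _ => 1
  have main : ∀ w, (∀ t : FTerm k, t.numbers ⊆ A → W t < w → Acc (D.Below N A) t) →
      ∀ r (f : Sym k), D.rank f = r → ∀ t : FTerm k, t.numbers ⊆ A → W t ≤ w → t.head = .sym f →
        (∀ u ∈ t.args, Acc (D.Below N A) u) → Acc (D.Below N A) t := by
    intro w IHw r
    induction r using Nat.strong_induction_on with
    | _ r IHr =>
      rintro f rfl t₀ ht₀ hw₀ hf₀ ha₀
      refine list_lex_induction (r := D.Below N A) (D.statusArgs t₀).length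
        (P := fun L => ∀ t : FTerm k, t.numbers ⊆ A → W t ≤ w → t.head = .sym f →
          (∀ u ∈ t.args, Acc (D.Below N A) u) → D.statusArgs t = L → Acc (D.Below N A) t)
        ?_ (D.statusArgs t₀) rfl (fun u hu => ha₀ u (mem_args_of_mem_statusArgs hu))
        t₀ ht₀ hw₀ hf₀ ha₀ rfl
      rintro L hL hLacc IHL t ht hw hf ha rfl
      refine ⟨_, fun s hs => ?_⟩
      induction s using FTerm.args_induction with
      | h s IHs =>
        obtain ⟨hsA, hgt⟩ := hs
        have harg : (∀ u ∈ s.args, D.FGt N t u) → ∀ u ∈ s.args, Acc (D.Below N A) u :=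
          fun h u hu => IHs u hu ⟨(numbers_subset_of_mem_args hu).trans hsA, h u hu⟩
        have hws : W s ≤ w := (hgt.wge _ D.assignment_one).trans hw
        rcases hg : s.head with y | a | g
        · cases s <;> simp [head] at hg
          exact acc_var _
        · cases s <;> simp [head] at hg
          exact acc_cst hA _ hsA
        · cases hgt with
          | weight h => exact IHw s hsA ((h _ D.assignment_one).trans_le hw)
          | subEq _ hm => exact ha s hm
          | sub _ hm h => exact (ha _ hm).inv ⟨hsA, h⟩
          | prec _ hp h =>
            rw [hf, hg] at hp
            exact IHr _ hp g rfl s hsA hws hg (harg h)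
          | lex pre u v us vs _ hh h hst hss huv =>
            have hv : v ∈ s.args := mem_args_of_mem_statusArgs (D := D) (by simp [hss])
            refine IHL pre u v us vs hst ?_ ?_
              ⟨(numbers_subset_of_mem_args hv).trans hsA, huv⟩ s hsA hws (hh ▸ hf) (harg h) hss
            · rw [← hss, ← length_statusArgs hh, hL]
            · rw [← hss]
              exact fun u hu => harg h u (mem_args_of_mem_statusArgs hu)
  have all : ∀ w, ∀ t : FTerm k, t.numbers ⊆ A → W t = w → Acc (D.Below N A) t := by
    intro w
    induction w using Nat.strong_induction_on with
    | _ w IHw =>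
      intro t ht hw
      have hlt : ∀ t : FTerm k, t.numbers ⊆ A → W t < w → Acc (D.Below N A) t :=
        fun t ht h => IHw _ h t ht rfl
      -- Only an upper bound is kept, because arguments may be lighter than the term.
      replace hw : W t ≤ w := hw.le
      induction t using FTerm.args_induction with
      | h t ih =>
        rcases hg : t.head with y | a | g
        · cases t <;> simp [head] at hg
          exact acc_var _
        · cases t <;> simp [head] at hg
          exact acc_cst hA _ ht
        · exact main w hlt _ g rfl t ht hw hg fun u hu =>
            ih u hu ((numbers_subset_of_mem_args hu).trans ht)
              ((FTerm.weight_arg_le D (fun _ => le_rfl) hu).trans hw)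
  exact all _ t ht rfl

theorem wellFoundedOn_of_finite [IsStrictTotalOrder Number N] (hA : A.Finite) :
    A.WellFoundedOn fun m n => N n m :=
  hA.wellFoundedOn (r := Function.swap N)

theorem FGt.irrefl [IsStrictTotalOrder Number N] (t : FTerm k) : ¬ D.FGt N t t := fun h =>
  not_acc_of_descending (f := fun _ => t) (fun _ => ⟨subset_rfl, h⟩)
    (acc_below (D := D) (wellFoundedOn_of_finite t.finite_numbers) t subset_rfl)

end AWPO

/-! ## Substitutions and relabellings -/

theorem ATerm.subst_var (a : ATerm) : a.subst .var = a := by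
  induction a <;> simp_all [subst]

theorem ATerm.subst_subst (σ τ : ℕ → ATerm) (a : ATerm) :
    (a.subst σ).subst τ = a.subst fun x => (σ x).subst τ := by
  induction a <;> simp_all [subst]

theorem ATerm.vars_subst {σ : ℕ → ATerm} (hσ : ∀ x, (σ x).vars = ∅) (a : ATerm) :
    (a.subst σ).vars = ∅ := by
  induction a <;> simp_all [subst, vars]

/-- The substitution `δ` followed by the substitution `σ`. -/
def Subst.comp (δ σ : Subst k) : Subst k where
  fg x := (δ.fg x).subst σ
  bg x := (δ.bg x).subst σ.bg

theorem Term.subst_subst (δ σ : Subst k) (t : Term k) :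
    (t.subst δ).subst σ = t.subst (δ.comp σ) := by
  induction t <;> simp_all [subst, Subst.comp, ATerm.subst_subst]

theorem Formula.subst_subst (δ σ : Subst k) (φ : Formula k) :
    (φ.subst δ).subst σ = φ.subst (δ.comp σ) := by
  induction φ <;> simp_all [subst, Term.subst_subst]

theorem Rule.OrdinaryVia.comp {I : Set (Set (Formula k))} (hI : IsSatisfaction I) {ρ : Rule k}
    {δ : Subst k} (h : ρ.OrdinaryVia I δ) (σ : Subst k) : ρ.OrdinaryVia I (δ.comp σ) := by
  have := hI.stable _ h σ
  rw [Set.image_image] at this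
  simp only [Formula.subst_subst] at this
  exact this

theorem Term.ground_subst {δ : Subst k} (hfg : ∀ x, (δ.fg x).Ground)
    (hbg : ∀ x, (δ.bg x).vars = ∅) (t : Term k) : (t.subst δ).Ground := by
  induction t with
  | var x => exact hfg x
  | quote a => exact ⟨rfl, ATerm.vars_subst hbg a⟩
  | app1 f t ih => exact ih
  | app2 f s t ihs iht =>
    exact ⟨by simp [subst, fgVars, ihs.1, iht.1], by simp [subst, bgVars, ihs.2, iht.2]⟩
  | _ => exact ⟨rfl, rfl⟩

theorem Term.quotes_subst {δ : Subst k} (hfg : ∀ x, (δ.fg x).quotes = ∅) (t : Term k) :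
    (t.subst δ).quotes = ATerm.subst δ.bg '' t.quotes := by
  induction t <;> simp_all [subst, quotes, Set.image_union]

theorem Term.toF_simplify {φ : ATerm → ATerm} (hφ : ∀ q, φ (.num q) = .num q) (t : Term k) :
    (t.simplify φ).toF = t.toF.relabel φ := by
  induction t <;> simp_all [simplify, toF, FTerm.relabel]

theorem Term.simplify_simplify (φ ψ : ATerm → ATerm) (t : Term k) :
    (t.simplify φ).simplify ψ = t.simplify (ψ ∘ φ) := by
  induction t <;> simp_all [simplify]

theorem Ctx.exists_fill_simplify (φ : ATerm → ATerm) (c : Ctx k) :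
    ∃ c' : Ctx k, ∀ u, (c.fill u).simplify φ = c'.fill (u.simplify φ) := by
  induction c with
  | hole => exact ⟨.hole, fun _ => rfl⟩
  | app1 f c ih =>
    obtain ⟨c', h⟩ := ih
    exact ⟨.app1 f c', fun u => by simp [fill, Term.simplify, h]⟩
  | app2l f c t ih =>
    obtain ⟨c', h⟩ := ih
    exact ⟨.app2l f c' (t.simplify φ), fun u => by simp [fill, Term.simplify, h]⟩
  | app2r f t c ih =>
    obtain ⟨c', h⟩ := ih
    exact ⟨.app2r f (t.simplify φ) c', fun u => by simp [fill, Term.simplify, h]⟩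

theorem Ctx.exists_fill_subst (σ : Subst k) (c : Ctx k) :
    ∃ c' : Ctx k, ∀ u, (c.fill u).subst σ = c'.fill (u.subst σ) := by
  induction c with
  | hole => exact ⟨.hole, fun _ => rfl⟩
  | app1 f c ih =>
    obtain ⟨c', h⟩ := ih
    exact ⟨.app1 f c', fun u => by simp [fill, Term.subst, h]⟩
  | app2l f c t ih =>
    obtain ⟨c', h⟩ := ih
    exact ⟨.app2l f c' (t.subst σ), fun u => by simp [fill, Term.subst, h]⟩
  | app2r f t c ih =>
    obtain ⟨c', h⟩ := ih
    exact ⟨.app2r f (t.subst σ) c', fun u => by simp [fill, Term.subst, h]⟩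

/-! ## Limits of simplification -/

/-- The arithmetic term `a` becomes the number `q` when it is simplified repeatedly. -/
def SimplifiesTo (simp : ATerm → ATerm) (a : ATerm) (q : Number) : Prop :=
  ∃ n : ℕ, simp^[n] a = .num q

/-- The number that `a` becomes when it is simplified repeatedly, with an arbitrary value if there
is none. -/
noncomputable def limitNumber (simp : ATerm → ATerm) (a : ATerm) : Number :=
  @Classical.epsilon _ ⟨Number.ofInt 0⟩ (SimplifiesTo simp a)

/-- The number that `a` becomes when it is simplified repeatedly, as an arithmetic term. -/
noncomputable def limit (simp : ATerm → ATerm) (a : ATerm) : ATerm := .num (limitNumber simp a)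

section Limit

variable {simp : ATerm → ATerm}

theorem limit_num (hsimp : IsCanonizer simp) (q : Number) : limit simp (.num q) = .num q := by
  have h : SimplifiesTo simp (.num q) = fun r => q = r := by
    funext r
    have : ∀ n : ℕ, simp^[n] (.num q) = .num q := fun n =>
      Function.iterate_fixed (hsimp.num q) n
    simp [SimplifiesTo, this]
  have := @Classical.epsilon_spec _ (fun r => q = r) ⟨q, rfl⟩
  rw [limit, limitNumber, h, ← this]

theorem limit_comp (hsimp : IsCanonizer simp) : limit simp ∘ simp = limit simp := by
  funext a
  -- The two predicates coincide, so `epsilon` makes the same choice for both, even when no iterate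
  -- is a number.
  have h : SimplifiesTo simp (simp a) = SimplifiesTo simp a := by
    funext r
    refine propext ⟨fun ⟨n, h⟩ => ⟨n + 1, h⟩, fun ⟨n, h⟩ => ?_⟩
    cases n with
    | zero =>
      refine ⟨0, ?_⟩
      rw [Function.iterate_zero, id] at h
      simp [h, hsimp.num]
    | succ n => exact ⟨n, h⟩
  simp [limit, limitNumber, h]

end Limit

/-- The substitution that replaces foreground variables by a number. -/
def numSubst : Subst k where
  fg _ := .num (Number.ofInt 0)
  bg := .var

/-- The ground instance of a term where all quoted terms are replaced by their limits. -/
noncomputable def Term.grounding (simp : ATerm → ATerm) (t : Term k) : Term k :=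
  (t.subst numSubst).simplify (limit simp)

/-- Background variables must survive until the limit is taken, since `simp` need not commute with
substitution; this is why `numSubst` fixes them. -/
theorem Term.grounding_simplify {simp : ATerm → ATerm} (hsimp : IsCanonizer simp) (t : Term k) :
    (t.simplify simp).grounding simp = t.grounding simp := by
  have h : ∀ a, limit simp (simp a) = limit simp a := fun a => congrFun (limit_comp hsimp) a
  unfold grounding
  induction t <;> simp_all [simplify, subst, numSubst, ATerm.subst_var]

/-- The substitution whose instances are the groundings of admissible terms. -/
noncomputable def limitSubst (simp : ATerm → ATerm) : Subst k where
  fg _ := .num (Number.ofInt 0)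
  bg x := limit simp (.var x)

/-- In general, limits do not commute with the arithmetic operations. An admissible term quotes only
numbers and variables, and on these taking limits is a substitution. -/
theorem AdmissibleLhs.grounding_eq {simp : ATerm → ATerm} (hsimp : IsCanonizer simp) {t : Term k}
    (ht : AdmissibleLhs t) : t.grounding simp = t.subst (limitSubst simp) := by
  unfold Term.grounding
  induction t with
  | quote a =>
    rcases ht a rfl with ⟨q, rfl⟩ | ⟨x, rfl⟩
    · simp [Term.subst, Term.simplify, ATerm.subst, limit_num hsimp]
    · simp [Term.subst, Term.simplify, ATerm.subst, numSubst, limitSubst]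
  | app1 f t ih => simpa [Term.subst, Term.simplify] using ih ht
  | app2 f s t ihs iht =>
    simpa [Term.subst, Term.simplify] using
      ⟨ihs fun a ha => ht a (.inl ha), iht fun a ha => ht a (.inr ha)⟩
  | _ => rfl

theorem ground_subst_comp_limitSubst {simp : ATerm → ATerm} (δ : Subst k) (t : Term k) :
    (t.subst (δ.comp (limitSubst simp))).Ground := by
  rw [← Term.subst_subst]
  exact Term.ground_subst (fun _ => ⟨rfl, rfl⟩) (fun _ => rfl) _

/-! ## Well-behaved rules -/

theorem Term.Ground.weight_eq {t : Term k} (ht : t.Ground) (g : ℕ → ℕ → ℕ) (α β : ℕ → ℕ) :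
    t.toF.weight g α = t.toF.weight g β := by
  replace ht := ht.1
  induction t with
  | var x => simp [fgVars] at ht
  | app1 f t ih => cases f <;> simp [toF, weight, ih ht]
  | app2 f s t ihs iht =>
    simp only [fgVars, Finset.union_eq_empty] at ht
    cases f <;> simp [toF, weight, ihs ht.1, iht ht.2]
  | _ => rfl

variable {D : AWPO k} {N : Number → Number → Prop}

/-- Weights of ground terms do not depend on the assignment, so only equal weights matter. From `l +
⟨0⟩ ≻ l + 0` the replacement property gives `l + ⟨0⟩ ≻ r + 0` (summands swapped for right-to-left
status). Both sums weigh the same and more than any summand, so the comparison is lexicographic. -/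
theorem AWPO.Gt.of_sum_replacement [IsStrictTotalOrder Number N] {l r : Term k} (hl : l.Ground)
    (hr : r.Ground) (hlr : D.GtT N l r)
    (h : ∀ (s : Term k) (c : Ctx k), s.Ground → (c.fill l).Ground →
      D.Gt s (c.fill l) → D.Gt s (c.fill r)) : D.Gt l r := by
  have hle := FGt.wge hlr _ D.assignment_one
  rcases hle.lt_or_eq with hlt | heq
  · refine .weight fun α _ => ?_
    rwa [hl.weight_eq _ α fun _ => 1, hr.weight_eq _ α fun _ => 1]
  have hne : r.toF ≠ l.toF := fun he => by
    unfold AWPO.GtT at hlr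
    rw [he] at hlr
    exact FGt.irrefl _ hlr
  let z : ATerm := .num (Number.ofInt 0)
  have hz : D.FGt (fun _ _ => False) (.kwote z) (.cst z) := fGt_of_mem_args (by simp [args])
  -- the context puts `l` first according to the status of `+`
  have key : ∀ s u : FTerm k, (D.FGt (fun _ _ => False) s u) → s.head = .sym (.fn2 .add) →
      u.head = .sym (.fn2 .add) → D.statusArgs s = [l.toF, .kwote z] →
      D.statusArgs u = [r.toF, .cst z] →
      (∀ v ∈ s.args, v = l.toF ∨ v = .kwote z) →
      s.weight D.wdiv (fun _ => 1) = l.toF.weight D.wdiv (fun _ => 1) + 2 →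
      u.weight D.wdiv (fun _ => 1) = l.toF.weight D.wdiv (fun _ => 1) + 2 →
      D.Gt l r := by
    intro s u hsu hs hu hss hus hargs hws hwu
    have hlarge : ∀ v ∈ s.args,
        v.weight D.wdiv (fun _ => 1) < u.weight D.wdiv (fun _ => 1) := by
      intro v hv
      rcases hargs v hv with rfl | rfl
      · omega
      · simp only [weight]; omega
    cases hsu with
    | weight h =>
      have := h _ D.assignment_one
      omega
    | subEq _ hm => exact absurd (hlarge _ hm) (lt_irrefl _)
    | sub _ hm h => exact absurd (hlarge _ hm) (h.wge _ D.assignment_one).not_gt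
    | prec _ hp _ =>
      rw [hs, hu] at hp
      exact absurd hp (lt_irrefl _)
    | lex pre v w vs ws _ _ _ h1 h2 hvw =>
      rw [hss] at h1
      rw [hus] at h2
      -- With an empty prefix, `l` itself is compared with `r`; a nonempty prefix would force `l`
      -- and `r` to coincide.
      cases pre with
      | nil =>
        simp only [List.nil_append, List.cons.injEq] at h1 h2
        rw [← h1.1, ← h2.1] at hvw
        exact hvw
      | cons p pre =>
        simp only [List.cons_append, List.cons.injEq] at h1 h2
        exact absurd (h2.1.trans h1.1.symm) hne
  by_cases hf : D.ltr .add = true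
  · refine key (Term.app2 .add l (.quote z)).toF (Term.app2 .add r (.num (Number.ofInt 0))).toF
      (h (.app2 .add l (.quote z)) (.app2l .add .hole (.num (Number.ofInt 0))) ?_ ?_ ?_)
      rfl rfl (by simp [Term.toF, statusArgs, hf]) (by simp [Term.toF, statusArgs, hf, z])
      (by simp [Term.toF, args]) (by simp [Term.toF, weight]; omega)
      (by simp [Term.toF, weight]; omega)
    · exact ⟨by simp [Term.fgVars, hl.1], by simp [Term.bgVars, hl.2, ATerm.vars, z]⟩
    · exact ⟨by simp [Ctx.fill, Term.fgVars, hl.1], by simp [Ctx.fill, Term.bgVars, hl.2]⟩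
    · exact hz.app2_right .add l.toF
  · refine key (Term.app2 .add (.quote z) l).toF (Term.app2 .add (.num (Number.ofInt 0)) r).toF
      (h (.app2 .add (.quote z) l) (.app2r .add (.num (Number.ofInt 0)) .hole) ?_ ?_ ?_)
      rfl rfl (by simp [Term.toF, statusArgs, hf]) (by simp [Term.toF, statusArgs, hf, z])
      (by simp [Term.toF, args, or_comm]) (by simp [Term.toF, weight]; omega)
      (by simp [Term.toF, weight]; omega)
    · exact ⟨by simp [Term.fgVars, hl.1], by simp [Term.bgVars, hl.2, ATerm.vars, z]⟩
    · exact ⟨by simp [Ctx.fill, Term.fgVars, hl.1], by simp [Ctx.fill, Term.bgVars, hl.2]⟩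
    · exact hz.app2_left .add l.toF

theorem Rule.WellBehaved.gt_grounding [IsStrictTotalOrder Number N] {simp : ATerm → ATerm}
    (hsimp : IsCanonizer simp) {I : Set (Set (Formula k))} (hI : IsSatisfaction I) {ρ : Rule k}
    (hρ : ρ.WellBehaved D N I) {δ : Subst k} (hadm : AdmissibleLhs (ρ.lhs.subst δ))
    (hδ : ρ.OrdinaryVia I δ) :
    D.Gt ((ρ.lhs.subst δ).grounding simp) ((ρ.rhs.subst δ).grounding simp) := by
  rcases hρ with h | ⟨h, hb⟩
  · have := (h _ (hδ.comp hI numSubst)).relabel (limit_num hsimp)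
    rwa [← Term.subst_subst, ← Term.subst_subst, ← Term.toF_simplify (limit_num hsimp),
      ← Term.toF_simplify (limit_num hsimp)] at this
  · have hord := hδ.comp hI (limitSubst simp)
    have hlg := ground_subst_comp_limitSubst (simp := simp) δ ρ.lhs
    have hrg := ground_subst_comp_limitSubst (simp := simp) δ ρ.rhs
    obtain ⟨hq, hrep⟩ := hb _ hord hlg
    -- By (b1) each quoted term of the right side becomes a number under the limit substitution.
    -- Only numbers and variables can do so.
    have hradm : AdmissibleLhs (ρ.rhs.subst δ) := by
      have hempty : ∀ x, ((limitSubst simp : Subst k).fg x).quotes = ∅ := fun _ => rfl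
      rw [← Term.subst_subst, ← Term.subst_subst, Term.quotes_subst hempty,
        Term.quotes_subst hempty] at hq
      intro a ha
      obtain ⟨b, hbq, hba⟩ := hq (Set.mem_image_of_mem _ ha)
      have hnum : ∃ q, b.subst (limitSubst simp : Subst k).bg = .num q := by
        rcases hadm b hbq with ⟨q, rfl⟩ | ⟨x, rfl⟩
        · exact ⟨q, rfl⟩
        · exact ⟨_, rfl⟩
      obtain ⟨q, hq⟩ := hnum
      rw [hba] at hq
      cases a with
      | var x => exact .inr ⟨x, rfl⟩
      | num q => exact .inl ⟨q, rfl⟩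
      | _ => simp [ATerm.subst] at hq
    rw [hadm.grounding_eq hsimp, hradm.grounding_eq hsimp, Term.subst_subst, Term.subst_subst]
    exact AWPO.Gt.of_sum_replacement hlg hrg (h _ hord) hrep

theorem terminating_of_wellBehaved [IsStrictTotalOrder Number N] {simp : ATerm → ATerm}
    (hsimp : IsCanonizer simp) {I : Set (Set (Formula k))} (hI : IsSatisfaction I)
    {R : Set (Rule k)} (hR : ∀ ρ ∈ R, ρ.WellBehaved D N I) : Terminating simp I R := by
  rintro ⟨t, ht⟩
  -- For `≻` numbers are unrelated, so no restriction on the numbers is needed.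
  have hwf : (Set.univ : Set Number).WellFoundedOn fun m n => (fun _ _ => False) n m :=
    Set.wellFoundedOn_univ.2 ⟨fun a => ⟨a, fun _ h => h.elim⟩⟩
  refine not_acc_of_descending (f := fun n => ((t n).grounding simp).toF) (fun n => ?_)
    (acc_below (D := D) hwf _ (Set.subset_univ _))
  obtain ⟨ρ, hρ, -, c, δ, hadm, -, hδ, h1, h2⟩ := ht n
  refine ⟨Set.subset_univ _, ?_⟩
  obtain ⟨c₁, hc₁⟩ := c.exists_fill_subst numSubst
  obtain ⟨c₂, hc₂⟩ := c₁.exists_fill_simplify (limit simp)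
  have hfill : ∀ u, (c.fill u).grounding simp = c₂.fill (u.grounding simp) := fun u => by
    rw [Term.grounding, hc₁, hc₂]
    rfl
  rw [h1, h2, hfill, hfill, Term.grounding_simplify hsimp]
  exact FGt.fill c₂ ((hR ρ hρ).gt_grounding hsimp hI hadm hδ)

/-! ## A strictly monotone weight -/

/-- A strictly monotone weight for which `+` and `×` are associative and commutative, and which does
not depend on the constants. -/
def Term.size : Term k → ℕ
  | .var _ => 1
  | .num _ => 1
  | .param _ => 1
  | .quote _ => 1
  | .app1 .sin t => 2 * 32 ^ t.size
  | .app1 .cos t => 32 ^ t.size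
  | .app1 .succ t => t.size + 1
  | .app2 .add s t => 1 + (s.size + t.size)
  | .app2 .mul s t => 2 * (s.size * t.size)
  | .app2 .pow s t => 3 * s.size ^ 3 * t.size
  | .app2 .div s t => s.size + t.size
  | .app2 .sinN n t => (4 * 32 ^ t.size + 3) ^ n.size
  | .app2 .cosN n t => (4 * 32 ^ t.size + 3) ^ n.size
  | .app2 .pwrN t n => (2 * t.size + 1) ^ n.size

theorem Term.size_pos (t : Term k) : 1 ≤ t.size := by
  induction t with
  | app1 f t ih =>
    have := Nat.one_le_pow t.size 32 (by norm_num)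
    cases f <;> simp only [size] <;> omega
  | app2 f s t ihs iht =>
    cases f <;> simp only [size]
    · omega
    · exact Nat.mul_pos two_pos (Nat.mul_pos ihs iht)
    · exact Nat.mul_pos (Nat.mul_pos three_pos (Nat.pow_pos ihs)) iht
    · omega
    · exact Nat.pow_pos (Nat.succ_pos _)
    · exact Nat.pow_pos (Nat.succ_pos _)
    · exact Nat.pow_pos (Nat.succ_pos _)
  | _ => exact le_rfl

theorem Term.size_simplify (φ : ATerm → ATerm) (t : Term k) : (t.simplify φ).size = t.size := by
  induction t with
  | app1 f t ih => cases f <;> simp [simplify, size, ih]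
  | app2 f s t ihs iht => cases f <;> simp [simplify, size, ihs, iht]
  | _ => rfl

theorem Term.size_app1_strictMono (f : Fn1) {s t : Term k} (h : t.size < s.size) :
    (app1 f t).size < (app1 f s).size := by
  have := Nat.pow_lt_pow_right (a := 32) (by norm_num) h
  cases f <;> simp only [size] <;> omega

/-- Strict monotonicity in each argument, which the weight of `/` in the ordering need not have,
carries a decrease of size through contexts. -/
theorem Term.size_app2_strictMono_left (f : Fn2) (u : Term k) {s t : Term k}
    (h : t.size < s.size) : (app2 f t u).size < (app2 f s u).size := by
  have hu := u.size_pos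
  have ht := t.size_pos
  have := Nat.one_le_pow u.size 32 (by norm_num)
  cases f <;> simp only [size]
  · omega
  · gcongr
  · gcongr
  · omega
  · exact Nat.pow_lt_pow_right (by omega) h
  · exact Nat.pow_lt_pow_right (by omega) h
  · exact Nat.pow_lt_pow_left (by omega) (by omega)

theorem Term.size_app2_strictMono_right (f : Fn2) (u : Term k) {s t : Term k}
    (h : t.size < s.size) : (app2 f u t).size < (app2 f u s).size := by
  have hu := u.size_pos
  have ht := t.size_pos
  have := Nat.pow_lt_pow_right (a := 32) (by norm_num) h
  cases f <;> simp only [size]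
  · omega
  · gcongr
  · gcongr
  · omega
  · exact Nat.pow_lt_pow_left (by omega) (by omega)
  · exact Nat.pow_lt_pow_left (by omega) (by omega)
  · exact Nat.pow_lt_pow_right (by omega) h

theorem Ctx.size_fill_lt (c : Ctx k) {s t : Term k} (h : t.size < s.size) :
    (c.fill t).size < (c.fill s).size := by
  induction c with
  | hole => exact h
  | app1 f c ih => exact Term.size_app1_strictMono f ih
  | app2l f c u ih => exact Term.size_app2_strictMono_left f u ih
  | app2r f u c ih => exact Term.size_app2_strictMono_right f u ih

theorem Ctx.size_fill_congr (c : Ctx k) {s t : Term k} (h : t.size = s.size) :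
    (c.fill t).size = (c.fill s).size := by
  induction c with
  | hole => exact h
  | app1 f c ih => cases f <;> simp [fill, Term.size, ih]
  | app2l f c u ih => cases f <;> simp [fill, Term.size, ih]
  | app2r f u c ih => cases f <;> simp [fill, Term.size, ih]

/-! ## Rules that permute subterms -/

variable {simp : ATerm → ATerm}

/-- All instances of the rule decrease the size. -/
def Rule.SizeDecreasing (ρ : Rule k) : Prop :=
  ∀ δ : Subst k, (ρ.rhs.subst δ).size < (ρ.lhs.subst δ).size

/-- Ordinary instances preserve the size, introduce no numbers, and are oriented by the ground-total
ordering, all this after the replacement of quoted terms by their limits. -/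
def Rule.Permuting (D : AWPO k) (N : Number → Number → Prop) (simp : ATerm → ATerm)
    (ρ : Rule k) : Prop :=
  ∀ δ : Subst k, ρ.OrdinaryVia (orderSat (D.GtT N)) δ →
    (ρ.rhs.subst δ).size = (ρ.lhs.subst δ).size ∧
    D.FGt N ((ρ.lhs.subst δ).simplify (limit simp)).toF
      ((ρ.rhs.subst δ).simplify (limit simp)).toF ∧
    ((ρ.rhs.subst δ).simplify (limit simp)).toF.numbers ⊆
      ((ρ.lhs.subst δ).simplify (limit simp)).toF.numbers

theorem Ctx.numbers_fill (c : Ctx k) {s t : Term k} (h : s.toF.numbers ⊆ t.toF.numbers) :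
    (c.fill s).toF.numbers ⊆ (c.fill t).toF.numbers := by
  induction c with
  | hole => exact h
  | app1 f c ih => exact ih
  | app2l f c u ih => exact Set.union_subset_union_left _ ih
  | app2r f u c ih => exact Set.union_subset_union_right _ ih

/-- Foreground variables are not instantiated here: constraints evaluated by `≻ᵗ` need not be stable
under substitution, but relabelling by limits preserves them. -/
theorem terminating_of_sizeDecreasing_or_permuting [IsStrictTotalOrder Number N]
    (hsimp : IsCanonizer simp) {R : Set (Rule k)}
    (hR : ∀ ρ ∈ R, ρ.SizeDecreasing ∨ ρ.Permuting D N simp) :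
    Terminating simp (orderSat (D.GtT N)) R := by
  rintro ⟨t, ht⟩
  let T : ℕ → FTerm k := fun n => ((t n).simplify (limit simp)).toF
  have hstep : ∀ n, (t (n + 1)).size < (t n).size ∨ ((t (n + 1)).size = (t n).size ∧
      D.FGt N (T n) (T (n + 1)) ∧ (T (n + 1)).numbers ⊆ (T n).numbers) := by
    intro n
    obtain ⟨ρ, hρ, -, c, δ, -, -, hδ, h1, h2⟩ := ht n
    simp only [T, h1, h2]
    rcases hR ρ hρ with h | h
    · left
      refine c.size_fill_lt ?_
      rw [Term.size_simplify]
      exact h δ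
    · right
      obtain ⟨hs, hgt, hnum⟩ := h δ hδ
      obtain ⟨c', hc'⟩ := c.exists_fill_simplify (limit simp)
      rw [hc', hc', Term.simplify_simplify, limit_comp hsimp]
      refine ⟨c.size_fill_congr ?_, FGt.fill c' hgt, c'.numbers_fill hnum⟩
      rw [Term.size_simplify, hs]
  have hanti : Antitone fun n => (t n).size := antitone_nat_of_succ_le fun n => by
    rcases hstep n with h | h
    · exact h.le
    · exact h.1.le
  -- From `m` on the size is constant, so every step is permuting.
  obtain ⟨m, hm⟩ : ∃ m, ∀ n, m ≤ n → (t m).size = (t n).size :=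
    WellFoundedLT.antitone_chain_condition hanti
  have htail : ∀ n, D.FGt N (T (m + n)) (T (m + (n + 1))) ∧
      (T (m + (n + 1))).numbers ⊆ (T (m + n)).numbers := by
    intro n
    rcases hstep (m + n) with h | h
    · have h1 := hm (m + n) (by omega)
      have h2 := hm (m + n + 1) (by omega)
      omega
    · exact h.2
  have hsub : ∀ n, (T (m + n)).numbers ⊆ (T m).numbers := by
    intro n
    induction n with
    | zero => exact subset_rfl
    | succ n ih => exact (htail n).2.trans ih
  exact not_acc_of_descending (f := fun n => T (m + n))
    (fun n => ⟨hsub (n + 1), (htail n).1⟩)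
    (acc_below (D := D) (wellFoundedOn_of_finite (T m).finite_numbers) (T m) subset_rfl)

/-! ## Permutations in sums and products -/

/-- The weight of the symbol is associative and commutative, and larger than that of arguments. -/
def IsAC (f : Fn2) : Prop := f = .add ∨ f = .mul

theorem IsAC.weight_lt {f : Fn2} (hf : IsAC f) (D : AWPO k) (x y z : FTerm k) :
    ∀ α, D.Assignment α →
      y.weight D.wdiv α < (app2 f x (app2 f y z)).weight D.wdiv α ∧
      (app2 f y z).weight D.wdiv α < (app2 f x (app2 f y z)).weight D.wdiv α ∧
      (app2 f x z).weight D.wdiv α < (app2 f x (app2 f y z)).weight D.wdiv α ∧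
      (app2 f (app2 f x y) z).weight D.wdiv α = (app2 f x (app2 f y z)).weight D.wdiv α ∧
      (app2 f y (app2 f x z)).weight D.wdiv α = (app2 f x (app2 f y z)).weight D.wdiv α ∧
      (app2 f y x).weight D.wdiv α = (app2 f x y).weight D.wdiv α := by
  intro α hα
  have hx := weight_pos D hα.1 x
  have hy := weight_pos D hα.1 y
  have hz := weight_pos D hα.1 z
  rcases hf with rfl | rfl
  · simp only [weight]
    omega
  · simp only [weight]
    have hxy := Nat.mul_le_mul hx hy
    have hxz := Nat.mul_le_mul hx hz
    have hyz := Nat.mul_le_mul hy hz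
    have h1 := Nat.mul_le_mul hx (le_refl (y.weight D.wdiv α * z.weight D.wdiv α))
    have h2 := Nat.mul_le_mul hy (le_refl (x.weight D.wdiv α * z.weight D.wdiv α))
    have h3 := Nat.mul_le_mul (le_refl (y.weight D.wdiv α)) hz
    refine ⟨?_, ?_, ?_, ?_, ?_, ?_⟩
    · nlinarith
    · nlinarith
    · nlinarith
    · ring
    · ring
    · ring

/-- The weights agree, and the first arguments `x ∘ y` and `x` are a term and its subterm. -/
theorem AWPO.FGt.assoc {f : Fn2} (hf : IsAC f) (hltr : D.ltr f = true) (x y z : FTerm k) :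
    D.FGt N (app2 f (app2 f x y) z) (app2 f x (app2 f y z)) := by
  have hw := hf.weight_lt D x y z
  have hxy : D.FGt N (app2 f x y) x := fGt_of_mem_args (by simp [args])
  refine .lex [] (app2 f x y) x [z] [app2 f y z] (fun α hα => ?_) rfl ?_
    (by simp [statusArgs, hltr]) (by simp [statusArgs, hltr]) hxy
  · have := hw α hα
    omega
  · intro w hw'
    simp only [args, List.mem_cons, List.not_mem_nil, or_false] at hw'
    rcases hw' with rfl | rfl
    · exact hxy.of_arg (by simp [args])
    · refine .weight fun α hα => ?_
      have := hw α hα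
      omega

theorem AWPO.FGt.comm {f : Fn2} (hf : IsAC f) (hltr : D.ltr f = true) {x y : FTerm k}
    (h : D.FGt N x y) : D.FGt N (app2 f x y) (app2 f y x) := by
  refine .lex [] x y [y] [x] (fun α hα => ?_) rfl ?_
    (by simp [statusArgs, hltr]) (by simp [statusArgs, hltr]) h
  · exact (hf.weight_lt D x y x α hα).2.2.2.2.2.le
  · intro w hw'
    simp only [args, List.mem_cons, List.not_mem_nil, or_false] at hw'
    rcases hw' with rfl | rfl <;> exact fGt_of_mem_args (by simp [args])

theorem AWPO.FGt.left_comm {f : Fn2} (hf : IsAC f) (hltr : D.ltr f = true) {x y : FTerm k}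
    (z : FTerm k) (h : D.FGt N x y) :
    D.FGt N (app2 f x (app2 f y z)) (app2 f y (app2 f x z)) := by
  have hw := hf.weight_lt D x y z
  refine .lex [] x y [app2 f y z] [app2 f x z] (fun α hα => (hw α hα).2.2.2.2.1.le) rfl ?_
    (by simp [statusArgs, hltr]) (by simp [statusArgs, hltr]) h
  intro w hw'
  simp only [args, List.mem_cons, List.not_mem_nil, or_false] at hw'
  rcases hw' with rfl | rfl
  · exact .weight fun α hα => (hw α hα).1
  · exact .weight fun α hα => (hw α hα).2.2.1

/-- Right-to-left status compares `x` with `y` first, so the coefficients, both of weight `1`, are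
irrelevant. -/
theorem AWPO.FGt.kwote_mul (hltr : D.ltr .mul ≠ true) (a b : ATerm) {x y : FTerm k}
    (h : D.FGt N x y) : D.FGt N (app2 .mul (kwote a) x) (app2 .mul (kwote b) y) := by
  refine .lex [] x y [kwote a] [kwote b] (fun α hα => ?_) rfl ?_
    (by simp [statusArgs, hltr]) (by simp [statusArgs, hltr]) h
  · exact weight_app2_mono D hα.1 _ le_rfl (h.wge α hα)
  · intro w hw'
    simp only [args, List.mem_cons, List.not_mem_nil, or_false] at hw'
    rcases hw' with rfl | rfl
    · refine .weight fun α hα => ?_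
      have := weight_pos D hα.1 x
      simp only [FTerm.weight]
      omega
    · exact h.of_arg (by simp [args])

theorem gt_limit_of_ordinaryVia (hsimp : IsCanonizer simp) {ρ : Rule k} (hρ : .gt vx vy ∈ ρ.C)
    {δ : Subst k} (h : ρ.OrdinaryVia (orderSat (D.GtT N)) δ) :
    D.FGt N ((δ.fg 0).simplify (limit simp)).toF ((δ.fg 1).simplify (limit simp)).toF := by
  obtain ⟨s, t, he, hst⟩ := h _ (Set.mem_image_of_mem _ hρ)
  simp only [Formula.subst, Formula.gt.injEq] at he
  rw [Term.toF_simplify (limit_num hsimp), Term.toF_simplify (limit_num hsimp)]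
  obtain ⟨rfl, rfl⟩ := he
  exact FGt.relabel (limit_num hsimp) hst

theorem permuting_assoc {f : Fn2} (hf : IsAC f) (hltr : D.ltr f = true) {ρ : Rule k}
    (hl : ρ.lhs = .app2 f (.app2 f vx vy) vz) (hr : ρ.rhs = .app2 f vx (.app2 f vy vz)) :
    ρ.Permuting D N simp := by
  intro δ _
  rw [hl, hr]
  refine ⟨?_, FGt.assoc hf hltr _ _ _, ?_⟩
  · rcases hf with rfl | rfl <;> simp [Term.subst, Term.size] <;> ring
  · simp [Term.subst, Term.simplify, Term.toF, numbers, Set.union_assoc]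

theorem permuting_comm (hsimp : IsCanonizer simp) {f : Fn2} (hf : IsAC f)
    (hltr : D.ltr f = true) {ρ : Rule k} (hC : .gt vx vy ∈ ρ.C)
    (hl : ρ.lhs = .app2 f vx vy) (hr : ρ.rhs = .app2 f vy vx) : ρ.Permuting D N simp := by
  intro δ hδ
  rw [hl, hr]
  refine ⟨?_, FGt.comm hf hltr (gt_limit_of_ordinaryVia hsimp hC hδ), ?_⟩
  · rcases hf with rfl | rfl <;> simp [Term.subst, Term.size] <;> ring
  · simp [Term.subst, Term.simplify, Term.toF, numbers, Set.union_comm]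

theorem permuting_left_comm (hsimp : IsCanonizer simp) {f : Fn2} (hf : IsAC f)
    (hltr : D.ltr f = true) {ρ : Rule k} (hC : .gt vx vy ∈ ρ.C)
    (hl : ρ.lhs = .app2 f vx (.app2 f vy vz)) (hr : ρ.rhs = .app2 f vy (.app2 f vx vz)) :
    ρ.Permuting D N simp := by
  intro δ hδ
  rw [hl, hr]
  refine ⟨?_, FGt.left_comm hf hltr _ (gt_limit_of_ordinaryVia hsimp hC hδ), ?_⟩
  · rcases hf with rfl | rfl <;> simp [Term.subst, Term.size] <;> ring
  · exact (Set.union_left_comm _ _ _).subset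

/-! ## Size estimates -/

section Estimates

variable {x y z v n : ℕ}

theorem size_pow_pow (hx : 1 ≤ x) (hy : 1 ≤ y) (hz : 1 ≤ z) :
    3 * x ^ 3 * (2 * (y * z)) < 3 * (3 * x ^ 3 * y) ^ 3 * z := by
  have h1 : 1 ≤ x ^ 3 := Nat.one_le_pow _ _ hx
  have h2 : 0 < x ^ 3 * y * z := Nat.mul_pos (Nat.mul_pos h1 hy) hz
  have h3 : 1 ≤ (x ^ 3) ^ 2 * y ^ 2 :=
    Nat.mul_pos (Nat.pow_pos h1) (Nat.pow_pos hy)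
  have e : 3 * (3 * x ^ 3 * y) ^ 3 * z = x ^ 3 * y * z * (81 * ((x ^ 3) ^ 2 * y ^ 2)) := by ring
  have e' : 3 * x ^ 3 * (2 * (y * z)) = x ^ 3 * y * z * 6 := by ring
  rw [e, e']
  exact Nat.mul_lt_mul_of_pos_left (by omega) h2

theorem size_pow_mul_pow (hx : 1 ≤ x) (hy : 1 ≤ y) (hz : 1 ≤ z) :
    3 * x ^ 3 * (1 + (y + z)) < 2 * (3 * x ^ 3 * y * (3 * x ^ 3 * z)) := by
  have h1 : 1 ≤ x ^ 3 := Nat.one_le_pow _ _ hx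
  have h2 : 1 + (y + z) < 6 * (y * z) := by nlinarith
  have h3 : y * z ≤ x ^ 3 * (y * z) := Nat.le_mul_of_pos_left _ h1
  have e : 2 * (3 * x ^ 3 * y * (3 * x ^ 3 * z)) = 3 * x ^ 3 * (6 * (x ^ 3 * (y * z))) := by ring
  rw [e]
  exact Nat.mul_lt_mul_of_pos_left (by omega) (by omega)

theorem size_pow_mul_pow_mul (hx : 1 ≤ x) (hy : 1 ≤ y) (hz : 1 ≤ z) (hv : 1 ≤ v) :
    2 * (3 * x ^ 3 * (1 + (y + z)) * v) < 2 * (3 * x ^ 3 * y * (2 * (3 * x ^ 3 * z * v))) := by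
  have h := Nat.mul_lt_mul_of_pos_right (size_pow_mul_pow hx hy hz) hv
  have e : 2 * (3 * x ^ 3 * y * (2 * (3 * x ^ 3 * z * v))) =
    2 * (2 * (3 * x ^ 3 * y * (3 * x ^ 3 * z)) * v) := by ring
  omega

theorem size_pwrN_succ : 2 * (x * (2 * x + 1) ^ n) < (2 * x + 1) ^ (n + 1) := by
  have h : 0 < (2 * x + 1) ^ n := Nat.pow_pos (Nat.succ_pos _)
  rw [pow_succ]
  nlinarith

theorem size_lt_pow_one (hx : 1 ≤ x) : x < 3 * x ^ 3 * 1 := by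
  have := Nat.le_self_pow (n := 3) (by norm_num) x
  omega

/-- The sides are `18` and `24` times `x ^ 3 * y ^ 3`. With the squared base of the ordering's
weight they would be equal, hence the cube. -/
theorem size_mul_pow (hx : 1 ≤ x) (hy : 1 ≤ y) :
    2 * (3 * x ^ 3 * 1 * (3 * y ^ 3 * 1)) < 3 * (2 * (x * y)) ^ 3 * 1 := by
  have h : 0 < x ^ 3 * y ^ 3 := Nat.mul_pos (Nat.pow_pos hx) (Nat.pow_pos hy)
  nlinarith

theorem size_double (hx : 1 ≤ x) : 2 * 32 ^ x < 32 ^ (2 * (1 * x)) := by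
  have h : 32 ^ 1 ≤ 32 ^ x := Nat.pow_le_pow_right (by norm_num) hx
  have e : 32 ^ (2 * (1 * x)) = 32 ^ x * 32 ^ x := by rw [one_mul, two_mul x, pow_add]
  rw [e]
  nlinarith

theorem size_sin_add : 1 + (2 * (2 * 32 ^ x * 32 ^ y) + 2 * (32 ^ x * (2 * 32 ^ y))) <
    2 * 32 ^ (1 + (x + y)) := by
  have h : 0 < 32 ^ x * 32 ^ y := Nat.mul_pos (Nat.pow_pos (by norm_num)) (Nat.pow_pos (by norm_num))
  rw [pow_add, pow_add]
  nlinarith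

/-- The left side is `18 * (32 ^ x * 32 ^ y) + 1`; the summand `1` in the size of `+` supplies a
factor `32` on the right. -/
theorem size_cos_add : 1 + (2 * (32 ^ x * 32 ^ y) + 2 * (2 * (1 * (2 * 32 ^ x)) * (2 * 32 ^ y))) <
    32 ^ (1 + (x + y)) := by
  have h : 0 < 32 ^ x * 32 ^ y := Nat.mul_pos (Nat.pow_pos (by norm_num)) (Nat.pow_pos (by norm_num))
  rw [pow_add, pow_add]
  nlinarith

/-- With `c = 32 ^ x`, split `(4c + 3)²` as `4c(4c + 3) + 3(4c + 3)`. The first part matches the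
first summand exactly, and the second exceeds the rest. -/
theorem size_cosN_succ_succ :
    1 + (2 * (1 * (2 * (32 ^ x * (4 * 32 ^ x + 3) ^ (n + 1)))) + 2 * (1 * (4 * 32 ^ x + 3) ^ n)) <
      (4 * 32 ^ x + 3) ^ (n + 1 + 1) := by
  generalize 32 ^ x = c
  have h : 0 < (4 * c + 3) ^ n := Nat.pow_pos (Nat.succ_pos _)
  rw [pow_succ _ (n + 1), pow_succ]
  generalize (4 * c + 3) ^ n = t at *
  nlinarith [Nat.zero_le (t * c)]

theorem size_sinN_succ_succ :
    1 + (2 * (2 * (1 * 32 ^ x) * (4 * 32 ^ x + 3) ^ (n + 1)) + 2 * (1 * (4 * 32 ^ x + 3) ^ n)) <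
      (4 * 32 ^ x + 3) ^ (n + 1 + 1) := by
  have e : 2 * (2 * (1 * 32 ^ x) * (4 * 32 ^ x + 3) ^ (n + 1)) =
    2 * (1 * (2 * (32 ^ x * (4 * 32 ^ x + 3) ^ (n + 1)))) := by ring
  rw [e]
  exact size_cosN_succ_succ

/-- The factor `2` by which sine exceeds cosine becomes `8` when cubed, giving `24` against `6`. -/
theorem size_sin_sq :
    1 + (1 + 2 * (1 * (3 * (32 ^ x) ^ 3 * 1))) < 3 * (2 * 32 ^ x) ^ 3 * 1 := by
  have h : 0 < (32 ^ x) ^ 3 := Nat.pow_pos (Nat.pow_pos (by norm_num))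
  rw [mul_pow]
  omega

theorem size_trigN_one : 2 * 32 ^ (2 * (1 * x)) < (4 * 32 ^ x + 3) ^ (1 + 1) := by
  have e : 32 ^ (2 * (1 * x)) = 32 ^ x * 32 ^ x := by rw [one_mul, two_mul x, pow_add]
  rw [e, one_add_one_eq_two]
  generalize 32 ^ x = c
  nlinarith

theorem size_trigN_zero (hx : 1 ≤ x) : 2 * 32 ^ 1 < (4 * 32 ^ x + 3) ^ 1 := by
  have h : 32 ^ 1 ≤ 32 ^ x := Nat.pow_le_pow_right (by norm_num) hx
  rw [pow_one] at h
  rw [pow_one, pow_one]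
  omega

end Estimates

/-! ## The systems -/

theorem canon_sizeDecreasing_or_permuting (hsimp : IsCanonizer simp)
    (hltr : ∀ f, D.ltr f = true) : ∀ ρ ∈ canon k, ρ.SizeDecreasing ∨ ρ.Permuting D N simp := by
  intro ρ hρ
  have hadd : IsAC .add := .inl rfl
  have hmul : IsAC .mul := .inr rfl
  simp only [canon, Set.mem_insert_iff, Set.mem_singleton_iff] at hρ
  rcases hρ with rfl | rfl | rfl | rfl | rfl | rfl | rfl | rfl | rfl | rfl | rfl | rfl | rfl | rfl | rfl | rfl | rfl | rfl | rfl |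
    rfl | rfl | rfl | rfl | rfl | rfl | rfl | rfl | rfl | rfl | rfl | rfl | rfl | rfl | rfl | rfl | rfl | rfl | rfl
  · exact .inr (permuting_assoc hadd (hltr _) rfl rfl)
  · exact .inr (permuting_comm hsimp hadd (hltr _) rfl rfl rfl)
  · exact .inr (permuting_left_comm hsimp hadd (hltr _) rfl rfl rfl)
  -- The five size-decreasing rules for addition move to the end of the goal list.
  rotate_left 5
  · exact .inr (permuting_assoc hmul (hltr _) rfl rfl)
  · exact .inr (permuting_comm hsimp hmul (hltr _) rfl rfl rfl)
  · exact .inr (permuting_left_comm hsimp hmul (hltr _) rfl rfl rfl)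
  all_goals
    refine .inl fun δ => ?_
    have hx := (δ.fg 0).size_pos
    have hy := (δ.fg 1).size_pos
    have hz := (δ.fg 2).size_pos
    have hv := (δ.fg 3).size_pos
    simp only [Rule.plain, Term.subst, Term.size, Term.add, Term.mul, Term.pow, Term.sin, Term.cos,
      Term.succ, Term.sinN, Term.cosN, Term.pwrN, Term.qint, vx, vy, vz, vv, vn, qa, qb]
    generalize (δ.fg 0).size = x at *
    generalize (δ.fg 1).size = y at *
    generalize (δ.fg 2).size = z at *
    generalize (δ.fg 3).size = v at *
    generalize (δ.fg 4).size = n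
  · omega
  · omega
  · omega
  · nlinarith
  · nlinarith
  · exact size_pow_pow hx hy hz
  · exact size_pow_mul_pow hx hy hz
  · exact size_pow_mul_pow_mul hx hy hz hv
  · omega
  · exact Nat.one_lt_pow (by omega) (by omega)
  · exact size_pwrN_succ
  · exact size_lt_pow_one (by omega)
  · exact size_mul_pow hx hy
  · exact hx.trans_lt (size_lt_pow_one hx)
  · have := size_double hx
    omega
  · have := size_double hx
    omega
  · exact size_sin_add
  · exact size_cos_add
  · exact size_cosN_succ_succ
  · exact size_sinN_succ_succ
  · exact size_sin_sq
  · have := size_trigN_one (x := x)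
    omega
  · have := size_trigN_zero hx
    omega
  · exact size_trigN_one
  · exact size_trigN_zero hx
  · omega
  · omega
  · omega
  · omega
  · omega
  · omega
  · omega

theorem simpSystem_sizeDecreasing_or_permuting (hsimp : IsCanonizer simp)
    (hltr : ∀ f, D.ltr f = true ↔ f ≠ .mul) :
    ∀ ρ ∈ simpSystem k, ρ.SizeDecreasing ∨ ρ.Permuting D N simp := by
  intro ρ hρ
  have hadd : D.ltr .add = true := (hltr _).2 (by simp)
  have hmul : D.ltr .mul ≠ true := fun h => (hltr _).1 h rfl
  simp only [simpSystem, Set.mem_insert_iff, Set.mem_singleton_iff] at hρ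
  rcases hρ with rfl | rfl | rfl | rfl
  · refine .inr fun δ hδ => ⟨?_, FGt.comm (.inl rfl) hadd
      (FGt.kwote_mul hmul _ _ (gt_limit_of_ordinaryVia hsimp (ρ := .ordered _ _ _ _ _) rfl hδ)), ?_⟩
    · simp only [Rule.ordered, Term.add, Term.mul, Term.subst, Term.size]
      ring
    · exact (Set.union_comm _ _).subset
  · refine .inr fun δ hδ => ⟨?_, FGt.left_comm (.inl rfl) hadd _
      (FGt.kwote_mul hmul _ _ (gt_limit_of_ordinaryVia hsimp (ρ := .ordered _ _ _ _ _) rfl hδ)), ?_⟩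
    · simp only [Rule.ordered, Term.add, Term.mul, Term.subst, Term.size]
      ring
    · exact (Set.union_left_comm _ _ _).subset
  all_goals
    refine .inl fun δ => ?_
    have hx := (δ.fg 0).size_pos
    simp only [Rule.plain, Term.subst, Term.size, Term.add, Term.mul, vx, vz, qa, qb]
    omega

end Ari

theorem mainTheorem3 {k : ℕ} (D : Ari.AWPO k)
    (N : Ari.Number → Ari.Number → Prop) (hN : IsStrictTotalOrder Ari.Number N)
    (simp : Ari.ATerm → Ari.ATerm) (hsimp : Ari.IsCanonizer simp) :
    (∀ I : Set (Set (Ari.Formula k)), Ari.IsSatisfaction I →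
      ∀ R : Set (Ari.Rule k), (∀ ρ ∈ R, ρ.WellBehaved D N I) → Ari.Terminating simp I R) ∧
    ((∀ f, D.ltr f = true) →
      Ari.Terminating simp (Ari.orderSat (D.GtT N)) (Ari.canon k)) ∧
    ((∀ f, D.ltr f = true ↔ f ≠ Ari.Fn2.mul) →
      Ari.Terminating simp (Ari.orderSat (D.GtT N)) (Ari.simpSystem k)) := by
  refine ⟨fun I hI R hR => Ari.terminating_of_wellBehaved hsimp hI hR, fun hltr => ?_,
    fun hltr => ?_⟩
  · exact Ari.terminating_of_sizeDecreasing_or_permuting hsimp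
      (Ari.canon_sizeDecreasing_or_permuting hsimp hltr)
  · exact Ari.terminating_of_sizeDecreasing_or_permuting hsimp
      (Ari.simpSystem_sizeDecreasing_or_permuting hsimp hltr)
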